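/- **Setting.** Let $\mathcal S$ be a measurable state space, $\mathcal A$ a finite non-empty action set, $r:\mathcal S\times\mathcal A\to[0,1]$ a known measurable reward, $\gamma\in[0,1)$, $\mu_0$ an initial distribution. For a transition kernel $P(\cdot\mid s,a)$ and a (measurable) policy $\pi:\mathcal S\to\Delta(\mathcal A)$ let $Q^\pi_P(s,a)=\mathbb E[\sum_{t\ge0}\gamma^t r(s_t,a_t)\mid s_0=s,a_0=a]$, $V^\pi_P=\mathbb E[\sum_{t\ge 0}\gamma^t r(s_t,a_t)\mid s_0\sim\mu_0]$, and let $d^\pi_P=(1-\gamma)\sum_{t\ge0}\gamma^t\,\mathrm{Pr}((s_t,a_t)\in\cdot\mid s_0\sim\mu_0)$ be the occupancy measure; $d^\pi_P(s)$ denotes its state marginal. For measures, $\sup d\nu/d\mu\in[0,\infty]$ is the least $c$ with $\nu\le c\mu$. **Data.** $\mathcal D=(s_i,a_i,r_i,s_i')_{i\le n}$ is i.i.d. with $(s_i,a_i)\sim\rho$, $r_i=r(s_i,a_i)$, $s_i'\sim P^*(\cdot\mid s_i,a_i)$. Let $\mathcal P\ni P^*$ be a set of transition kernels, $\widehat L_n$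 a data-dependent loss on $\mathcal P$ with minimizer $\widehat P$, $\alpha_n\in\mathbb R$, and $\mathcal P_{n,\alpha_n}=\{P\in\mathcal P:\widehat L_n(P)-\widehat L_n(\widehat P)\le\alpha_n\}$. Assume $P^*\in\mathcal P_{n,\alpha_n}$ with probability at least $1-p$. Put $\varepsilon_{est}=\sup_{P\in\mathcal P_{n,\alpha_n}}\mathbb E_{(s,a)\sim\rho}\|P(\cdot\mid s,a)-P^*(\cdot\mid s,a)\|_1$. Let $\pi^\dagger$ be a comparator policy with $C_{\pi^\dagger}=\sup_{s,a}d^{\pi^\dagger}_{P^*}(s,a)/\rho(s,a)<\infty$. **Mirror map.** $\omega$ is strongly convex with modulus $1$ on $\Delta(\mathcal A)$ with respect to some norm on $\mathbb R^{\mathcal A}$, and $\nabla\omega$ exists at the uniform vector and at every maximizer over $\Delta(\mathcal A)$ of a function $p\mapsto\langle g,p\rangle-\omega(p)$, $g\in\mathbb R^{\mathcal A}$ (e.g. $\omega$ is the negative entropy, or is differentiable everywhere). **Algorithm.** Let $T,N\ge1$, $\eta=\eta_t=(1-\gamma)\sqrt{2\log|\mathcal A|/T}$, and let $\mathcal F_{t,i}$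 ($t<T$, $i\in\mathcal A$) be classes of measurable functions on $\mathcal S$ with absolute values at most $B$, where $B\ge 1/(1-\gamma)$; $|\mathcal F_{t,i}|$ is the cardinality. Start with $\pi_0$ uniform. In iteration $t=0,\dots,T-1$: (i) an oracle returns $P_t\in\arg\min_{P\in\mathcal P_{n,\alpha_n}}V^{\pi_t}_P$; (ii) given the past, draw $s_1,\dots,s_N$ i.i.d. from $d^{\pi_t}_{P_t}$ and, for each action $i$ and each $j$, a Monte Carlo rollout $\widehat Q_{j,i}=\sum_{h=0}^{H}r(s^{(h)},a^{(h)})$ along a trajectory of $(P_t,\pi_t)$ from $(s_j,i)$ with an independent $H$, $\mathrm{Pr}(H=k)=(1-\gamma)\gamma^k$ (for fixed $i$ the pairs $(s_j,\widehat Q_{j,i})_{j\le N}$ are i.i.d.); (iii) let $\widehat f_{t,i}\in\arg\min_{f\in\mathcal F_{t,i}}\frac1N\sum_j\bigl(\widehat Q_{j,i}+\tfrac1\eta\nabla\omega(\pi_t(\cdot\mid s_j))_i-f(s_j)\bigr)^2$; (iv) let $\pi_{t+1}(\cdot\mid s)\in\arg\max_{p\in\Delta(\mathcal A)}\{\sum_i\widehat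 f_{t,i}(s)p_i-\frac1\eta\omega(p)\}$ for all $s$. Put $\widetilde Q_t(s,i)=Q^{\pi_t}_{P_t}(s,i)+\frac1\eta\nabla\omega(\pi_t(\cdot\mid s))_i$ and $\varepsilon_{approx}=\sup_{P\in\mathcal P,\,\pi,\,t<T,\,i}\ \inf_{f\in\mathcal F_{t,i}}\|\widetilde Q_t(\cdot,i)-f\|_{L^2(d^\pi_P)}$. Let $\widehat\pi$ be uniform over $\pi_0,\dots,\pi_{T-1}$, so that $V^{\widehat\pi}_{P^*}=\frac1T\sum_{t<T}V^{\pi_t}_{P^*}$. **Theorem.** For every $\delta>0$ there is a constant $c_1$ depending only on $\delta$, and for every $\mathcal A$, norm and $\omega$ a constant $c_2$ depending only on these and $\delta$, such that in the setting above, for all data sets outside an event of probability at most $p$, and given the data set with probability at least $1-\delta$ over the sampling of the algorithm, $$V^{\pi^\dagger}_{P^*}-V^{\widehat\pi}_{P^*}\le c_1\Bigl(\tfrac{\gamma}{(1-\gamma)^2}+\tfrac{\gamma}{(1-\gamma)^3}\Bigr)C_{\pi^\dagger}\varepsilon_{est}+\frac{c_2}{(1-\gamma)^2\sqrt T}+\frac{c_1|\mathcal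 A|}{(1-\gamma)^{3/2}}\sqrt{\sup_s\frac{d^{\pi^\dagger}_{P^*}(s)}{\mu_0(s)}}\Bigl(\varepsilon_{approx}+B\,\frac{\sqrt{\max_{t,i}|\mathcal F_{t,i}|}}{\sqrt N}\Bigr).$$ -/

import Mathlib

open MeasureTheory ProbabilityTheory
open scoped ENNReal NNReal

noncomputable section

namespace MoMA

/-! ### Markov decision processes, policies and trajectories -/

/-- The known part of a discounted Markov decision process on the state space `S` with action
space `A`: a reward `r : S × A → [0, 1]`, a discount factor `γ ∈ [0, 1)` and an initial state
distribution `μ₀`. -/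
structure MDP (S A : Type*) [MeasurableSpace S] [MeasurableSpace A] where
  r : S × A → ℝ
  measurable_r : Measurable r
  r_mem : ∀ x, r x ∈ Set.Icc (0 : ℝ) 1
  γ : ℝ
  γ_mem : γ ∈ Set.Ico (0 : ℝ) 1
  μ₀ : Measure S
  isProb : IsProbabilityMeasure μ₀

attribute [instance] MDP.isProb

/-- Transition dynamics `P(s' ∣ s, a)`: Markov kernels from state-action pairs to states. -/
abbrev Transition (S A : Type*) [MeasurableSpace S] [MeasurableSpace A] :=
  {P : Kernel (S × A) S // IsMarkovKernel P}

instance {S A : Type*} [MeasurableSpace S] [MeasurableSpace A] (P : Transition S A) :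
    IsMarkovKernel P.1 := P.2

/-- A stochastic policy: a measurable map from states to the probability simplex over the finite
set of actions. -/
structure Policy (S A : Type*) [MeasurableSpace S] [Fintype A] where
  prob : S → A → ℝ
  mem_simplex : ∀ s, prob s ∈ stdSimplex ℝ A
  measurable_prob : ∀ a, Measurable fun s => prob s a

section Trajectories

variable {S A : Type*} [MeasurableSpace S] [Fintype A] [MeasurableSpace A]
  [MeasurableSingletonClass A]

/-- The policy as a Markov kernel from states to actions. -/
def Policy.kernel (π : Policy S A) : Kernel S A where
  toFun s := ∑ a, ENNReal.ofReal (π.prob s a) • Measure.dirac a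
  measurable' := by
    refine Measure.measurable_of_measurable_coe _ fun E _ => ?_
    simp only [Measure.finsetSum_apply, Measure.smul_apply, smul_eq_mul]
    exact Finset.measurable_sum _ fun a _ => ((π.measurable_prob a).ennreal_ofReal).mul_const _

instance (π : Policy S A) : IsMarkovKernel π.kernel where
  isProbabilityMeasure s := ⟨by
    change (∑ a, ENNReal.ofReal (π.prob s a) • Measure.dirac a : Measure A) Set.univ = 1
    simp only [Measure.finsetSum_apply, Measure.smul_apply, smul_eq_mul, measure_univ, mul_one]
    rw [← ENNReal.ofReal_sum_of_nonneg fun a _ => (π.mem_simplex s).1 a, (π.mem_simplex s).2]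
    simp⟩

/-- Draw an action from the policy and keep the state: `s ↦ (s, a)` with `a ∼ π(· ∣ s)`. -/
def actKernel (π : Policy S A) : Kernel S (S × A) := Kernel.id ×ₖ π.kernel

instance (π : Policy S A) : IsMarkovKernel (actKernel π) := by
  unfold actKernel; infer_instance

/-- One step of the state-action chain: `s' ∼ P(· ∣ s, a)`, then `a' ∼ π(· ∣ s')`. -/
def stepKernel (P : Transition S A) (π : Policy S A) : Kernel (S × A) (S × A) :=
  actKernel π ∘ₖ P.1

instance (P : Transition S A) (π : Policy S A) : IsMarkovKernel (stepKernel P π) := by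
  unfold stepKernel; infer_instance

/-- The one-step kernel, seen as a kernel from histories up to time `n`. -/
def histKernel (P : Transition S A) (π : Policy S A) (n : ℕ) :
    Kernel (Π _ : Finset.Iic n, S × A) (S × A) :=
  (stepKernel P π).comap (fun h => h ⟨n, Finset.mem_Iic.2 le_rfl⟩) (measurable_pi_apply _)

instance (P : Transition S A) (π : Policy S A) (n : ℕ) : IsMarkovKernel (histKernel P π n) := by
  unfold histKernel; infer_instance

/-- The law (Ionescu-Tulcea) of the trajectory `(s_t, a_t)_{t ≥ 0}` started at a given
state-action pair `(s_0, a_0)`. -/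
def trajKernel (P : Transition S A) (π : Policy S A) : Kernel (S × A) (ℕ → S × A) :=
  (Kernel.traj (X := fun _ => S × A) (histKernel P π) 0).comap (fun x _ => x)
    (measurable_pi_lambda _ fun _ => measurable_id)

instance (P : Transition S A) (π : Policy S A) : IsMarkovKernel (trajKernel P π) := by
  unfold trajKernel; infer_instance

/-- The law of the trajectory started at a given state, with `a_0 ∼ π(· ∣ s_0)`. -/
def stateTrajKernel (P : Transition S A) (π : Policy S A) : Kernel S (ℕ → S × A) :=
  trajKernel P π ∘ₖ actKernel π

instance (P : Transition S A) (π : Policy S A) : IsMarkovKernel (stateTrajKernel P π) := by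
  unfold stateTrajKernel; infer_instance

variable (M : MDP S A)

/-- The discounted return `∑_t γ^t r(s_t, a_t)` of a trajectory. -/
def discountedReturn (x : ℕ → S × A) : ℝ := ∑' t, M.γ ^ t * M.r (x t)

/-- The action-value function `Q_P^π(s, a)`. -/
def Qfun (P : Transition S A) (π : Policy S A) (s : S) (a : A) : ℝ :=
  ∫ x, discountedReturn M x ∂(trajKernel P π (s, a))

/-- The value function `V_P^π(s)`. -/
def Vfun (P : Transition S A) (π : Policy S A) (s : S) : ℝ :=
  ∫ x, discountedReturn M x ∂(stateTrajKernel P π s)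

/-- The expected value `V_P^π = E_{s ∼ μ₀} V_P^π(s)`. -/
def value (P : Transition S A) (π : Policy S A) : ℝ := ∫ s, Vfun M P π s ∂M.μ₀

/-- The occupancy measure `d_P^π = (1 - γ) ∑_t γ^t Pr((s_t, a_t) ∈ · ∣ s_0 ∼ μ₀)`. -/
def occupancy (P : Transition S A) (π : Policy S A) : Measure (S × A) :=
  Measure.sum fun t : ℕ => ENNReal.ofReal ((1 - M.γ) * M.γ ^ t) •
    ((M.μ₀.bind (stateTrajKernel P π)).map fun x => x t)

/-- The state marginal of the occupancy measure. -/
def stateOccupancy (P : Transition S A) (π : Policy S A) : Measure S :=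
  (occupancy M P π).map Prod.fst

end Trajectories

/-- `sup dν/dμ`: the least `c ∈ [0, ∞]` with `ν ≤ c μ`
(infinite unless `ν` has a bounded density). -/
def densitySup {X : Type*} [MeasurableSpace X] (ν μ : Measure X) : ℝ≥0∞ :=
  sInf {c : ℝ≥0∞ | ν ≤ c • μ}

/-- The `L¹` distance `‖μ - ν‖₁` of two finite measures: the total mass of `|μ - ν|`. -/
def l1dist {X : Type*} [MeasurableSpace X] (μ ν : Measure X) [IsFiniteMeasure μ]
    [IsFiniteMeasure ν] : ℝ≥0∞ :=
  (μ.toSignedMeasure - ν.toSignedMeasure).totalVariation Set.univ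

/-! ### Offline data and the confidence set -/

section Data

variable {S A : Type*} [MeasurableSpace S] [Fintype A] [MeasurableSpace A]
  [MeasurableSingletonClass A]

/-- An offline data set `(s_i, a_i, r_i, s_i')_{i = 1, …, n}`. -/
abbrev Dataset (S A : Type*) (n : ℕ) := Fin n → S × A × ℝ × S

/-- The law of `n` i.i.d. records with `(s, a) ∼ ρ`, reward `r(s, a)`, `s' ∼ P(· ∣ s, a)`. -/
def dataLaw (M : MDP S A) (ρ : Measure (S × A)) (P : Transition S A) (n : ℕ) :
    Measure (Dataset S A n) :=
  Measure.pi fun _ => (ρ ⊗ₘ P.1).map fun z => (z.1.1, z.1.2, M.r z.1, z.2)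

/-- The confidence set `{P ∈ 𝒫 : L̂(P) - L̂(P̂) ≤ α}`. -/
def confSet (model : Set (Transition S A)) (loss : Transition S A → ℝ) (Phat : Transition S A)
    (α : ℝ) : Set (Transition S A) :=
  {P ∈ model | loss P - loss Phat ≤ α}

/-- The estimation error `sup_{P ∈ C} E_{(s,a) ∼ ρ} ‖P(· ∣ s, a) - P*(· ∣ s, a)‖₁`. -/
def epsEst (ρ : Measure (S × A)) (Pstar : Transition S A) (C : Set (Transition S A)) : ℝ≥0∞ :=
  ⨆ P ∈ C, ∫⁻ x, l1dist (P.1 x) (Pstar.1 x) ∂ρ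

end Data

/-! ### The mirror map -/

/-- A function `ω` on the simplex `Δ(A)` that is strongly convex with modulus `1` with respect to
a norm `nrm` on `ℝ^A` and whose gradient exists at every policy vector that mirror ascent started
at the uniform vector can produce. The last two fields hold if `ω` is differentiable on the whole
simplex, and also for the negative entropy, which is differentiable only in the interior. -/
structure MirrorMap (A : Type*) [Fintype A] where
  nrm : Seminorm ℝ (A → ℝ)
  nrm_eq_zero : ∀ x, nrm x = 0 → x = 0
  ω : (A → ℝ) → ℝ
  strong_convex : ∀ p ∈ stdSimplex ℝ A, ∀ q ∈ stdSimplex ℝ A, ∀ b c : ℝ, 0 ≤ b → 0 ≤ c →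
    b + c = 1 → ω (b • p + c • q) ≤ b * ω p + c * ω q - b * c / 2 * nrm (p - q) ^ 2
  diff_unif : DifferentiableAt ℝ ω fun _ => (Fintype.card A : ℝ)⁻¹
  diff_argmax : ∀ g : A → ℝ, ∀ p ∈ stdSimplex ℝ A,
    IsMaxOn (fun q => ∑ a, g a * q a - ω q) (stdSimplex ℝ A) p → DifferentiableAt ℝ ω p

open Classical in
/-- The `a`-th coordinate of `∇ω(p)`. -/
def MirrorMap.grad {A : Type*} [Fintype A] (W : MirrorMap A) (p : A → ℝ) (a : A) : ℝ :=
  fderiv ℝ W.ω p (Pi.single a 1)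

/-! ### The algorithm -/

lemma measurable_rolloutSum {S A : Type*} [MeasurableSpace S] [MeasurableSpace A]
    (M : MDP S A) :
    Measurable fun y : ℕ × (ℕ → S × A) => ∑ h ∈ Finset.range (y.1 + 1), M.r (y.2 h) :=
  measurable_from_prod_countable_right fun k =>
    Finset.measurable_sum (Finset.range (k + 1)) fun h _ =>
      M.measurable_r.comp (measurable_pi_apply h)

section Algorithm

variable {S A : Type*} [MeasurableSpace S] [Fintype A] [MeasurableSpace A]
  [MeasurableSingletonClass A]

/-- The step size `(1 - γ) √(2 log |A| / T)`. -/
def stepSize (M : MDP S A) (T : ℕ) : ℝ :=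
  (1 - M.γ) * √(2 * Real.log (Fintype.card A) / T)

/-- The augmented action-value function `Q_P^π(s, a) + (1 / η) ∇ω(π(· ∣ s))_a`. -/
def augQ (M : MDP S A) (W : MirrorMap A) (η : ℝ) (P : Transition S A) (π : Policy S A)
    (a : A) (s : S) : ℝ :=
  Qfun M P π s a + 1 / η * W.grad (π.prob s) a

/-- The success probability `1 - γ` of the stopping coin of a Monte Carlo rollout. -/
def stopProb (M : MDP S A) : unitInterval :=
  ⟨1 - M.γ, by have := M.γ_mem; constructor <;> linarith [this.1, this.2]⟩

/-- The law of the Monte Carlo estimate of `Q_P^π(s, a)`: follow the trajectory from `(s, a)`,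
before every further step stop with probability `1 - γ`, and return the undiscounted sum of the
rewards that have been collected. -/
def rolloutKernel (M : MDP S A) (P : Transition S A) (π : Policy S A) (a : A) : Kernel S ℝ :=
  ((Kernel.const S (geometricMeasure (stopProb M))) ×ₖ
    ((trajKernel P π).comap (fun s => (s, a)) (measurable_id.prodMk measurable_const))).map
    fun y : ℕ × (ℕ → S × A) => ∑ h ∈ Finset.range (y.1 + 1), M.r (y.2 h)

instance (M : MDP S A) (P : Transition S A) (π : Policy S A) (a : A) :
    IsMarkovKernel (rolloutKernel M P π a) := by
  unfold rolloutKernel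
  exact Kernel.IsMarkovKernel.map _ (measurable_rolloutSum M)

/-- The law of `(s_j, q_j)`: a state from `d_P^π` and a rollout started from it with action `a`. -/
def sampleLaw (M : MDP S A) (P : Transition S A) (π : Policy S A) (a : A) : Measure (S × ℝ) :=
  stateOccupancy M P π ⊗ₘ rolloutKernel M P π a

/-- The empirical square loss of `f` for the labels `q_j + (1 / η) ∇ω(π(· ∣ s_j))_a`. -/
def empLoss (W : MirrorMap A) (η : ℝ) {N : ℕ} (π : Policy S A) (a : A) (st : Fin N → S)
    (q : Fin N → ℝ) (f : S → ℝ) : ℝ :=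
  (N : ℝ)⁻¹ * ∑ j, (q j + 1 / η * W.grad (π.prob (st j)) a - f (st j)) ^ 2

/-- A run, on a probability space `(Ω, ν)` that carries the internal randomness, of `T` iterations
of the practical mirror-ascent algorithm with confidence set `C`, step size `η`, function classes
`F t a` and `N` Monte Carlo samples per iteration. -/
structure Run (M : MDP S A) (W : MirrorMap A) (C : Set (Transition S A)) (η : ℝ) (T N : ℕ)
    (F : ℕ → A → Set (S → ℝ)) {Ω : Type*} [mΩ : MeasurableSpace Ω] (ν : Measure Ω) where
  /-- the information available before iteration `t` -/
  𝒢 : Filtration ℕ mΩ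
  /-- the constrained-minimization oracle -/
  oracle : ℕ → Policy S A → Transition S A
  policy : ℕ → Ω → Policy S A
  state : ℕ → Fin N → Ω → S
  rollout : ℕ → A → Fin N → Ω → ℝ
  fhat : ℕ → A → Ω → S → ℝ
  /-- `π_0` is uniform. -/
  policy_zero : ∀ o s a, (policy 0 o).prob s a = (Fintype.card A : ℝ)⁻¹
  /-- `P_t` minimizes `V_P^{π_t}` over the confidence set. -/
  oracle_mem : ∀ t < T, ∀ o, oracle t (policy t o) ∈ C
  oracle_min : ∀ t < T, ∀ o, ∀ P ∈ C,
    value M (oracle t (policy t o)) (policy t o) ≤ value M P (policy t o)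
  measurable_state : ∀ t < T, ∀ j, Measurable[𝒢 (t + 1)] (state t j)
  measurable_rollout : ∀ t < T, ∀ a j, Measurable[𝒢 (t + 1)] (rollout t a j)
  /-- Given the past, for every action the states with their rollouts are `N` independent draws
  from the sampling law of the current policy `π_t` and model `P_t`. -/
  sample_law : ∀ t < T, ∀ a, ∀ G, MeasurableSet[𝒢 t] G → ∀ E, MeasurableSet E →
    ν (G ∩ {o | (fun j => (state t j o, rollout t a j o)) ∈ E}) =
      ∫⁻ o in G, Measure.pi
        (fun _ : Fin N => sampleLaw M (oracle t (policy t o)) (policy t o) a) E ∂ν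
  /-- The fitted function is an empirical risk minimizer over the function class. -/
  fhat_mem : ∀ t < T, ∀ a o, fhat t a o ∈ F t a
  fhat_min : ∀ t < T, ∀ a o, ∀ f ∈ F t a,
    empLoss W η (policy t o) a (fun j => state t j o) (fun j => rollout t a j o) (fhat t a o) ≤
      empLoss W η (policy t o) a (fun j => state t j o) (fun j => rollout t a j o) f
  measurable_fhat : ∀ t < T, ∀ a f, MeasurableSet[𝒢 (t + 1)] {o | fhat t a o = f}
  /-- `π_{t+1}(· ∣ s)` maximizes `⟨f_t(s), p⟩ - (1 / η) ω(p)` over the simplex. -/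
  policy_succ : ∀ t < T, ∀ o s,
    IsMaxOn (fun p : A → ℝ => ∑ a, fhat t a o s * p a - 1 / η * W.ω p) (stdSimplex ℝ A)
      ((policy (t + 1) o).prob s)

variable {M : MDP S A} {W : MirrorMap A} {C : Set (Transition S A)} {η : ℝ} {T N : ℕ}
  {F : ℕ → A → Set (S → ℝ)} {Ω : Type*} [MeasurableSpace Ω] {ν : Measure Ω}

/-- The model `P_t` that is used in iteration `t`. -/
def Run.model (R : Run M W C η T N F ν) (t : ℕ) (o : Ω) : Transition S A :=
  R.oracle t (R.policy t o)

/-- The value under `P` of the policy drawn uniformly from `π_0, …, π_{T-1}`. -/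
def Run.outputValue (R : Run M W C η T N F ν) (P : Transition S A) (o : Ω) : ℝ :=
  (T : ℝ)⁻¹ * ∑ t ∈ Finset.range T, value M P (R.policy t o)

/-- The approximation error: the supremum over models `P ∈ 𝒫`, policies `π`, iterations and
actions of the distance in `L²(d_P^π)` from the augmented action-value function of the iteration to
the function class. -/
def Run.epsApprox (R : Run M W C η T N F ν) (model : Set (Transition S A)) (o : Ω) : ℝ≥0∞ :=
  ⨆ P ∈ model, ⨆ π : Policy S A, ⨆ t ∈ Finset.range T, ⨆ a : A, ⨅ f ∈ F t a,
    eLpNorm (fun s => augQ M W η (R.model t o) (R.policy t o) a s - f s) 2 (stateOccupancy M P π)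

/-- `max_{t,a} |F_{t,a}|`, the largest cardinality of the function classes. -/
def maxCard (F : ℕ → A → Set (S → ℝ)) (T : ℕ) : ℝ≥0∞ :=
  ⨆ t ∈ Finset.range T, ⨆ a : A, (((F t a).encard : ℕ∞) : ℝ≥0∞)

end Algorithm

end MoMA

end

/-! The proof joins pessimism, the performance difference identity, inexact mirror ascent and least
squares.

Suppose `Pstar` lies in the confidence set. The model `P_t` minimizes the value of `π_t` there, so
the gap of `π_t` under `Pstar` is at most the value of the comparator under `Pstar` minus the value
of `π_t` under `P_t`. By `value_sub_value` this difference is `(1 - γ)⁻¹` times the sum of two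
averages over the occupancy of the comparator under `Pstar`: `γ` times the average of `(Pstar - P_t)
V_t`, and the average of `⟨πdag - π_t, Q_t⟩`.

Model error: `V_t` takes values in `[0, 1 / (1 - γ)]`, so an `L¹` bound and the density ratio with
respect to `ρ` give `γ / (1 - γ) ^ 2` times concentrability times estimation error
(`ofReal_modelError_le`).

Optimization error: the fitted functions approximate `Q_t + ∇ω(π_t) / η`, so maximizing `⟨f, p⟩ -
ω(p) / η` is a mirror ascent step up to the regression error. At each state
`MirrorMap.mirror_regret` bounds the sum over `t` by a telescoping Bregman term of order `1 / η`, a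
term of order `T η / (1 - γ) ^ 2`, and the absolute regression errors. The step size balances the
first two.

Regression error: the comparator's state occupancy is at most `κ μ₀`, and `(1 - γ) μ₀` is at most
the sampling distribution of any iteration. Hence an `L¹` error under the former is at most `√(κ /
(1 - γ))` times the `L²` error under the latter (`lintegral_enorm_le_eLpNorm`). Rollouts are
unbiased and unbounded, but have second moment of order `1 / (1 - γ) ^ 2`. For a finite class,
second moments suffice: summing normalized fluctuations over the class bounds the expected squared
error of the empirical minimizer (`exists_regression_bound`), which costs `√|F| / √N`.

The approximation error is itself random. The squared errors are therefore divided, before taking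
expectations, by a quantity fixed by the current policy and model; Markov's inequality is applied to
the sum of these ratios, and Cauchy-Schwarz returns to first powers (`Run.measure_sum_regError_le`).
Conditioning on the past is elementary because a mirror step has a unique maximizer: finite classes
produce only finitely many policies. Infinite classes or an infinite density ratio make the bound
infinite, and a single action makes the gap zero. -/

noncomputable section

namespace MoMA

set_option linter.unusedSectionVars false

/-! ### The state-action chain and its occupancy measures -/

section Weights

variable {S A : Type*} [MeasurableSpace S] [MeasurableSpace A] (M : MDP S A)

lemma MDP.one_sub_pos : 0 < 1 - M.γ := by linarith [M.γ_mem.2]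

lemma MDP.weight_nonneg (t : ℕ) : 0 ≤ (1 - M.γ) * M.γ ^ t :=
  mul_nonneg M.one_sub_pos.le (pow_nonneg M.γ_mem.1 t)

lemma MDP.hasSum_weight : HasSum (fun t => (1 - M.γ) * M.γ ^ t) 1 := by
  have := (hasSum_geometric_of_lt_one M.γ_mem.1 M.γ_mem.2).mul_left (1 - M.γ)
  rwa [mul_inv_cancel₀ M.one_sub_pos.ne'] at this

end Weights

section Chain

variable {S A : Type*} [MeasurableSpace S] [Fintype A] [MeasurableSpace A]
  [MeasurableSingletonClass A]

/-- The law of `(s_t, a_t)` given `(s_0, a_0)`. -/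
def chainKernel (P : Transition S A) (π : Policy S A) (t : ℕ) : Kernel (S × A) (S × A) :=
  (trajKernel P π).map fun x => x t

instance (P : Transition S A) (π : Policy S A) (t : ℕ) : IsMarkovKernel (chainKernel P π t) := by
  unfold chainKernel; exact Kernel.IsMarkovKernel.map _ (measurable_pi_apply t)

/-- The time `t` coordinate of the Ionescu-Tulcea law depends only on the trajectory up to `t`;
finite trajectories satisfy the one-step recursion used below. -/
lemma chainKernel_eq (P : Transition S A) (π : Policy S A) (t : ℕ) :
    chainKernel P π t = ((Kernel.partialTraj (X := fun _ => S × A) (histKernel P π) 0 t).map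
      (fun h => h ⟨t, Finset.mem_Iic.2 le_rfl⟩)).comap (fun x _ => x)
      (measurable_pi_lambda _ fun _ => measurable_id) := by
  have hm : Measurable fun h : (Π _ : Finset.Iic t, S × A) => h ⟨t, Finset.mem_Iic.2 le_rfl⟩ :=
    measurable_pi_apply _
  ext1 x
  rw [← Kernel.traj_map_frestrictLe, chainKernel, trajKernel, Kernel.comap_apply,
    Kernel.map_apply _ (measurable_pi_apply t), Kernel.comap_apply, Kernel.map_apply _ hm,
    Kernel.map_apply _ (Preorder.measurable_frestrictLe t),
    Measure.map_map hm (Preorder.measurable_frestrictLe t)]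
  rfl

lemma chainKernel_zero (P : Transition S A) (π : Policy S A) :
    chainKernel P π 0 = Kernel.id := by
  ext1 x
  rw [chainKernel_eq, Kernel.partialTraj_self, Kernel.comap_apply,
    Kernel.map_apply _ (measurable_pi_apply _), Kernel.id_apply, Kernel.id_apply,
    Measure.map_dirac' (measurable_pi_apply _)]

lemma chainKernel_succ (P : Transition S A) (π : Policy S A) (t : ℕ) :
    chainKernel P π (t + 1) = stepKernel P π ∘ₖ chainKernel P π t := by
  have h : (Kernel.partialTraj (X := fun _ => S × A) (histKernel P π) 0 (t + 1)).map
      (fun h => h ⟨t + 1, Finset.mem_Iic.2 le_rfl⟩) =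
      stepKernel P π ∘ₖ (Kernel.partialTraj (X := fun _ => S × A) (histKernel P π) 0 t).map
      (fun h => h ⟨t, Finset.mem_Iic.2 le_rfl⟩) := by
    have hm : Measurable fun h : (Π _ : Finset.Iic t, S × A) => h ⟨t, Finset.mem_Iic.2 le_rfl⟩ :=
      measurable_pi_apply _
    rw [Kernel.partialTraj_succ_eq_comp (Nat.zero_le t), Kernel.map_comp,
      Kernel.map_partialTraj_succ_self, Kernel.comp_map _ _ hm]
    rfl
  rw [chainKernel_eq, h, chainKernel_eq]
  ext1 x
  rw [Kernel.comap_apply, Kernel.comp_apply, Kernel.comp_apply, Kernel.comap_apply]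

/-- The chain is time-homogeneous, so the first step can be split off instead of the last. The
Bellman equation needs this order. -/
lemma chainKernel_succ' (P : Transition S A) (π : Policy S A) (t : ℕ) :
    chainKernel P π (t + 1) = chainKernel P π t ∘ₖ stepKernel P π := by
  induction t with
  | zero => rw [chainKernel_succ, chainKernel_zero, Kernel.comp_id, Kernel.id_comp]
  | succ t ih => rw [chainKernel_succ, ih, ← Kernel.comp_assoc, ← chainKernel_succ, ih]

lemma actKernel_apply (π : Policy S A) (s : S) :
    actKernel π s = ∑ a, ENNReal.ofReal (π.prob s a) • Measure.dirac (s, a) := by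
  rw [actKernel, Kernel.prod_apply, Kernel.id_apply, Measure.dirac_prod]
  change Measure.map (Prod.mk s) (∑ a, ENNReal.ofReal (π.prob s a) • Measure.dirac a) = _
  rw [← Measure.mapₗ_apply_of_measurable measurable_prodMk_left, map_sum]
  refine Finset.sum_congr rfl fun a _ => ?_
  rw [Measure.mapₗ_apply_of_measurable measurable_prodMk_left, Measure.map_smul,
    Measure.map_dirac' measurable_prodMk_left]

lemma integral_actKernel (π : Policy S A) (s : S) {f : S × A → ℝ} (hf : Measurable f) :
    ∫ x, f x ∂(actKernel π s) = ∑ a, π.prob s a * f (s, a) := by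
  rw [actKernel_apply, integral_finsetSum_measure]
  · refine Finset.sum_congr rfl fun a _ => ?_
    rw [integral_smul_measure, integral_dirac' _ _ hf.stronglyMeasurable,
      ENNReal.toReal_ofReal ((π.mem_simplex s).1 a), smul_eq_mul]
  · intro a _
    refine Integrable.smul_measure ?_ ENNReal.ofReal_ne_top
    exact (integrable_dirac' hf.stronglyMeasurable (by simp))

lemma actKernel_map_fst (π : Policy S A) : (actKernel π).map Prod.fst = Kernel.id := by
  rw [actKernel, ← Kernel.fst_eq, Kernel.fst_prod]

/-- The law of `(s_t, a_t)` when `s_0 ∼ μ₀`. -/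
def chainLaw (M : MDP S A) (P : Transition S A) (π : Policy S A) (t : ℕ) : Measure (S × A) :=
  (M.μ₀.bind (stateTrajKernel P π)).map fun x => x t

variable (M : MDP S A) (P : Transition S A) (π : Policy S A)

instance : IsProbabilityMeasure (M.μ₀.bind (stateTrajKernel P π)) := by
  infer_instance

instance (t : ℕ) : IsProbabilityMeasure (chainLaw M P π t) := by
  unfold chainLaw
  exact Measure.isProbabilityMeasure_map (measurable_pi_apply t).aemeasurable

lemma chainLaw_eq (t : ℕ) : chainLaw M P π t = (chainKernel P π t ∘ₖ actKernel π) ∘ₘ M.μ₀ := by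
  rw [chainLaw, chainKernel, ← Kernel.map_comp, ← Measure.map_comp _ _ (measurable_pi_apply t)]
  rfl

lemma chainLaw_zero : chainLaw M P π 0 = actKernel π ∘ₘ M.μ₀ := by
  rw [chainLaw_eq, chainKernel_zero, Kernel.id_comp]

lemma chainLaw_succ (t : ℕ) : chainLaw M P π (t + 1) = stepKernel P π ∘ₘ chainLaw M P π t := by
  rw [chainLaw_eq, chainKernel_succ, chainLaw_eq, Measure.comp_assoc, Kernel.comp_assoc]

lemma chainLaw_zero_map_fst : (chainLaw M P π 0).map Prod.fst = M.μ₀ := by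
  rw [chainLaw_zero, Measure.map_comp _ _ measurable_fst, actKernel_map_fst, Measure.id_comp]

lemma chainLaw_succ_map_fst (t : ℕ) :
    (chainLaw M P π (t + 1)).map Prod.fst = P.1 ∘ₘ chainLaw M P π t := by
  rw [chainLaw_succ, Measure.map_comp _ _ measurable_fst, stepKernel, Kernel.map_comp,
    actKernel_map_fst, Kernel.id_comp]

/-- At every time the action is drawn from the policy given the state, so the state marginal
determines the joint law. -/
lemma actKernel_comp_chainLaw_map_fst (t : ℕ) :
    actKernel π ∘ₘ (chainLaw M P π t).map Prod.fst = chainLaw M P π t := by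
  cases t with
  | zero => rw [chainLaw_zero_map_fst, chainLaw_zero]
  | succ t => rw [chainLaw_succ_map_fst, chainLaw_succ, stepKernel, Measure.comp_assoc]

lemma occupancy_eq : occupancy M P π =
    Measure.sum fun t => ENNReal.ofReal ((1 - M.γ) * M.γ ^ t) • chainLaw M P π t := rfl

instance : IsProbabilityMeasure (occupancy M P π) where
  measure_univ := by
    rw [occupancy_eq, Measure.sum_apply _ MeasurableSet.univ]
    simp only [Measure.smul_apply, measure_univ, smul_eq_mul, mul_one]
    rw [← ENNReal.ofReal_tsum_of_nonneg M.weight_nonneg M.hasSum_weight.summable,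
      M.hasSum_weight.tsum_eq, ENNReal.ofReal_one]

instance : IsProbabilityMeasure (stateOccupancy M P π) :=
  Measure.isProbabilityMeasure_map measurable_fst.aemeasurable

lemma hasSum_integral_occupancy {f : S × A → ℝ} (hf : Integrable f (occupancy M P π)) :
    HasSum (fun t => (1 - M.γ) * M.γ ^ t * ∫ x, f x ∂(chainLaw M P π t))
      (∫ x, f x ∂(occupancy M P π)) := by
  rw [occupancy_eq] at hf ⊢
  have h := hasSum_integral_measure hf
  simp only [integral_smul_measure, ENNReal.toReal_ofReal (M.weight_nonneg _), smul_eq_mul] at h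
  exact h

lemma actKernel_comp_stateOccupancy :
    actKernel π ∘ₘ stateOccupancy M P π = occupancy M P π := by
  ext E hE
  have hm : Measurable fun x : S × A => actKernel π x.1 E :=
    ((actKernel π).measurable_coe hE).comp measurable_fst
  rw [Measure.bind_apply hE (actKernel π).aemeasurable, stateOccupancy,
    lintegral_map ((actKernel π).measurable_coe hE) measurable_fst, occupancy_eq,
    lintegral_sum_measure, Measure.sum_apply _ hE]
  refine tsum_congr fun t => ?_
  rw [lintegral_smul_measure, Measure.smul_apply]
  conv_rhs => rw [← actKernel_comp_chainLaw_map_fst, Measure.bind_apply hE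
    (actKernel π).aemeasurable, lintegral_map ((actKernel π).measurable_coe hE) measurable_fst]

/-- Only the time `0` term of the occupancy series is kept; its weight is `1 - γ`. -/
lemma initial_le_stateOccupancy :
    ENNReal.ofReal (1 - M.γ) • M.μ₀ ≤ stateOccupancy M P π := by
  rw [stateOccupancy, ← chainLaw_zero_map_fst M P π, ← Measure.map_smul]
  refine Measure.map_mono ?_ measurable_fst
  rw [occupancy_eq]
  simpa using Measure.le_sum (fun t => ENNReal.ofReal ((1 - M.γ) * M.γ ^ t) • chainLaw M P π t) 0

end Chain

lemma hasSum_of_eq {f g : ℕ → ℝ} {a b : ℝ} (h : HasSum f a) (hfg : ∀ t, f t = g t) (hab : a = b) :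
    HasSum g b := by
  obtain rfl := funext hfg
  exact hab ▸ h

/-! ### Integrals of bounded functions against kernels -/

section General

variable {X Y : Type*} [MeasurableSpace X] [MeasurableSpace Y]

lemma integrable_of_bounded (μ : Measure X) [IsFiniteMeasure μ] {f : X → ℝ} (hf : Measurable f)
    {C : ℝ} (hC : ∀ x, |f x| ≤ C) : Integrable f μ :=
  Integrable.of_bound hf.aestronglyMeasurable C (.of_forall hC)

lemma abs_integral_le_of_bounded (μ : Measure X) [IsProbabilityMeasure μ] {f : X → ℝ} {C : ℝ}
    (hC : ∀ x, |f x| ≤ C) : |∫ x, f x ∂μ| ≤ C := by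
  simpa using norm_integral_le_of_norm_le_const (μ := μ) (f := f) (.of_forall hC)

lemma measurable_integral_kernel (κ : Kernel X Y) {f : Y → ℝ} (hf : Measurable f) :
    Measurable fun x => ∫ y, f y ∂κ x :=
  (hf.stronglyMeasurable.integral_kernel (κ := κ)).measurable

lemma integral_comp_kernel {Z : Type*} [MeasurableSpace Z] (η : Kernel Y Z) (κ : Kernel X Y)
    [IsMarkovKernel η] [IsMarkovKernel κ] {f : Z → ℝ} (hf : Measurable f) {C : ℝ}
    (hC : ∀ x, |f x| ≤ C) (x : X) :
    ∫ z, f z ∂(η ∘ₖ κ) x = ∫ y, ∫ z, f z ∂η y ∂κ x :=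
  Kernel.integral_comp (integrable_of_bounded _ hf hC)

lemma integral_comp_measure (κ : Kernel X Y) (μ : Measure X) [IsMarkovKernel κ]
    [IsProbabilityMeasure μ] {f : Y → ℝ} (hf : Measurable f) {C : ℝ} (hC : ∀ x, |f x| ≤ C) :
    ∫ y, f y ∂(κ ∘ₘ μ) = ∫ x, ∫ y, f y ∂κ x ∂μ := by
  have h := integral_comp_kernel κ (Kernel.const Unit μ) hf hC ()
  rwa [Kernel.comp_apply, Kernel.const_apply] at h

end General

/-! ### Bellman equation, flow equation and performance difference -/

section Bellman

variable {S A : Type*} [MeasurableSpace S] [Fintype A] [MeasurableSpace A]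
  [MeasurableSingletonClass A] (M : MDP S A) (P : Transition S A) (π : Policy S A)

lemma abs_reward_le (x : S × A) : |M.r x| ≤ 1 := by
  rw [abs_le]; constructor <;> linarith [(M.r_mem x).1, (M.r_mem x).2]

lemma hasSum_pow : HasSum (fun t => M.γ ^ t) (1 - M.γ)⁻¹ :=
  hasSum_geometric_of_lt_one M.γ_mem.1 M.γ_mem.2

lemma summable_discounted (x : ℕ → S × A) : Summable fun t => M.γ ^ t * M.r (x t) :=
  (hasSum_pow M).summable.of_nonneg_of_le
    (fun t => mul_nonneg (pow_nonneg M.γ_mem.1 t) (M.r_mem _).1)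
    fun t => mul_le_of_le_one_right (pow_nonneg M.γ_mem.1 t) (M.r_mem _).2

lemma measurable_discountedReturn : Measurable (discountedReturn M) :=
  Measurable.tsum fun t => (M.measurable_r.comp (measurable_pi_apply t)).const_mul _

lemma discountedReturn_mem (x : ℕ → S × A) :
    discountedReturn M x ∈ Set.Icc 0 (1 - M.γ)⁻¹ := by
  refine ⟨tsum_nonneg fun t => mul_nonneg (pow_nonneg M.γ_mem.1 t) (M.r_mem _).1, ?_⟩
  rw [← (hasSum_pow M).tsum_eq]
  exact (summable_discounted M x).tsum_le_tsum
    (fun t => mul_le_of_le_one_right (pow_nonneg M.γ_mem.1 t) (M.r_mem _).2) (hasSum_pow M).summable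

lemma abs_discountedReturn_le (x : ℕ → S × A) : |discountedReturn M x| ≤ (1 - M.γ)⁻¹ := by
  rw [abs_of_nonneg (discountedReturn_mem M x).1]; exact (discountedReturn_mem M x).2

/-- The expected return is the discounted sum of the expected rewards. -/
lemma hasSum_integral_discountedReturn (μ : Measure (ℕ → S × A)) [IsProbabilityMeasure μ] :
    HasSum (fun t => M.γ ^ t * ∫ z, M.r z ∂(μ.map fun x => x t))
      (∫ x, discountedReturn M x ∂μ) := by
  have hm (t : ℕ) : Measurable fun x : ℕ → S × A => M.r (x t) :=
    M.measurable_r.comp (measurable_pi_apply t)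
  have hi (t : ℕ) : Integrable (fun x : ℕ → S × A => M.γ ^ t * M.r (x t)) μ :=
    (integrable_of_bounded μ (hm t) fun x => abs_reward_le M _).const_mul _
  have h := hasSum_integral_of_summable_integral_norm (μ := μ)
    (F := fun t (x : ℕ → S × A) => M.γ ^ t * M.r (x t)) hi ?_
  · refine hasSum_of_eq h (fun t => ?_) rfl
    rw [integral_const_mul, integral_map (measurable_pi_apply t).aemeasurable
      M.measurable_r.aestronglyMeasurable]
  · refine (hasSum_pow M).summable.of_nonneg_of_le (fun t => by positivity) fun t => ?_
    refine (le_abs_self _).trans (abs_integral_le_of_bounded μ fun x => ?_)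
    rw [abs_norm, Real.norm_eq_abs, abs_mul, abs_of_nonneg (pow_nonneg M.γ_mem.1 t)]
    exact mul_le_of_le_one_right (pow_nonneg M.γ_mem.1 t) (abs_reward_le M _)

lemma abs_Qfun_le (s : S) (a : A) : |Qfun M P π s a| ≤ (1 - M.γ)⁻¹ :=
  abs_integral_le_of_bounded _ (abs_discountedReturn_le M)

lemma measurable_Qfun : Measurable fun x : S × A => Qfun M P π x.1 x.2 :=
  measurable_integral_kernel (trajKernel P π) (measurable_discountedReturn M)

lemma measurable_Vfun : Measurable (Vfun M P π) :=
  measurable_integral_kernel (stateTrajKernel P π) (measurable_discountedReturn M)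

lemma Vfun_mem (s : S) : Vfun M P π s ∈ Set.Icc 0 (1 - M.γ)⁻¹ :=
  ⟨integral_nonneg fun x => (discountedReturn_mem M x).1,
    (le_abs_self _).trans (abs_integral_le_of_bounded _ (abs_discountedReturn_le M))⟩

lemma abs_Vfun_le (s : S) : |Vfun M P π s| ≤ (1 - M.γ)⁻¹ :=
  abs_integral_le_of_bounded _ (abs_discountedReturn_le M)

lemma Vfun_eq_integral (s : S) :
    Vfun M P π s = ∫ x, Qfun M P π x.1 x.2 ∂(actKernel π s) :=
  integral_comp_kernel _ _ (measurable_discountedReturn M) (abs_discountedReturn_le M) s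

lemma Vfun_eq_sum (s : S) : Vfun M P π s = ∑ a, π.prob s a * Qfun M P π s a := by
  rw [Vfun_eq_integral, integral_actKernel π s (measurable_Qfun M P π)]

lemma hasSum_Qfun (x : S × A) :
    HasSum (fun t => M.γ ^ t * ∫ z, M.r z ∂(chainKernel P π t x)) (Qfun M P π x.1 x.2) := by
  have h := hasSum_integral_discountedReturn M (trajKernel P π x)
  simp_rw [chainKernel, Kernel.map_apply _ (measurable_pi_apply _)]
  exact h

/-- The Bellman equation. -/
lemma Qfun_eq (x : S × A) :
    Qfun M P π x.1 x.2 = M.r x + M.γ * ∫ s, Vfun M P π s ∂(P.1 x) := by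
  have h0 := hasSum_Qfun M P π x
  -- Without its time `0` term, which is the immediate reward, the series of `Q` is `γ` times the
  -- series averaged over the first step.
  rw [← hasSum_nat_add_iff' 1] at h0
  have hb (t : ℕ) (y : S × A) : |∫ z, M.r z ∂(chainKernel P π t y)| ≤ 1 :=
    abs_integral_le_of_bounded _ (abs_reward_le M)
  have hm (t : ℕ) : Measurable fun y => ∫ z, M.r z ∂(chainKernel P π t y) :=
    measurable_integral_kernel _ M.measurable_r
  have h1 := hasSum_integral_of_summable_integral_norm (μ := stepKernel P π x)
    (F := fun t y => M.γ ^ t * ∫ z, M.r z ∂(chainKernel P π t y))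
    (fun t => (integrable_of_bounded _ (hm t) (hb t)).const_mul _) (by
      refine (hasSum_pow M).summable.of_nonneg_of_le (fun t => by positivity) fun t => ?_
      refine (le_abs_self _).trans (abs_integral_le_of_bounded _ fun y => ?_)
      rw [abs_norm, Real.norm_eq_abs, abs_mul, abs_of_nonneg (pow_nonneg M.γ_mem.1 t)]
      exact mul_le_of_le_one_right (pow_nonneg M.γ_mem.1 t) (hb t y))
  have h2 := h1.mul_left M.γ
  have h3 := h2.unique (a₂ := Qfun M P π x.1 x.2 - M.r x) (by
    refine hasSum_of_eq h0 (fun t => ?_) ?_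
    · rw [chainKernel_succ', integral_comp_kernel _ _ M.measurable_r (abs_reward_le M),
        integral_const_mul]
      ring
    · simp [chainKernel_zero, Kernel.id_apply, integral_dirac' _ _ M.measurable_r.stronglyMeasurable])
  have h4 : ∫ y, ∑' t, M.γ ^ t * ∫ z, M.r z ∂(chainKernel P π t y) ∂(stepKernel P π x) =
      ∫ s, Vfun M P π s ∂(P.1 x) := by
    simp_rw [fun y => (hasSum_Qfun M P π y).tsum_eq]
    rw [stepKernel, integral_comp_kernel _ _ (measurable_Qfun M P π)
      (fun y => abs_Qfun_le M P π y.1 y.2)]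
    simp_rw [Vfun_eq_integral]
  rw [h4] at h3
  linarith

/-- Both sides sum the expected rewards with weights `γ ^ t`; the occupancy measure carries the
additional factor `1 - γ`. -/
lemma value_eq : value M P π = (1 - M.γ)⁻¹ * ∫ x, M.r x ∂(occupancy M P π) := by
  have h1 : value M P π = ∫ x, discountedReturn M x ∂(M.μ₀.bind (stateTrajKernel P π)) :=
    (integral_comp_measure _ _ (measurable_discountedReturn M) (abs_discountedReturn_le M)).symm
  have h2 := (hasSum_integral_discountedReturn M
    (M.μ₀.bind (stateTrajKernel P π))).mul_left (1 - M.γ)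
  have h3 := hasSum_integral_occupancy M P π
    (integrable_of_bounded _ M.measurable_r (abs_reward_le M))
  rw [h1, h3.unique (hasSum_of_eq h2 (fun t => (mul_assoc _ _ _).symm) rfl),
    inv_mul_cancel_left₀ M.one_sub_pos.ne']

lemma integrable_transition {V : S → ℝ} (hV : Measurable V) {C : ℝ} (hC : ∀ s, |V s| ≤ C)
    (P' : Transition S A) (μ : Measure (S × A)) [IsFiniteMeasure μ] :
    Integrable (fun x => ∫ s, V s ∂(P'.1 x)) μ :=
  integrable_of_bounded _ (measurable_integral_kernel P'.1 hV)
    fun _ => abs_integral_le_of_bounded _ hC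

/-- The flow equation of the occupancy measure. -/
lemma integral_flow {V : S → ℝ} (hV : Measurable V) {C : ℝ} (hC : ∀ s, |V s| ≤ C) :
    ∫ x, (V x.1 - M.γ * ∫ s, V s ∂(P.1 x)) ∂(occupancy M P π) =
      (1 - M.γ) * ∫ s, V s ∂M.μ₀ := by
  have hV1 : Measurable fun x : S × A => V x.1 := hV.comp measurable_fst
  have hI1 (μ : Measure (S × A)) [IsFiniteMeasure μ] : Integrable (fun x : S × A => V x.1) μ :=
    integrable_of_bounded μ hV1 fun x => hC x.1
  have hI2 (μ : Measure (S × A)) [IsFiniteMeasure μ] := integrable_transition hV hC P μ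
  set b : ℕ → ℝ := fun t => ∫ x, V x.1 ∂(chainLaw M P π t) with hb
  have hmap (t : ℕ) : b t = ∫ s, V s ∂((chainLaw M P π t).map Prod.fst) :=
    (integral_map measurable_fst.aemeasurable hV.aestronglyMeasurable).symm
  have hb0 : b 0 = ∫ s, V s ∂M.μ₀ := by rw [hmap, chainLaw_zero_map_fst]
  have hbs (t : ℕ) : b (t + 1) = ∫ x, ∫ s, V s ∂(P.1 x) ∂(chainLaw M P π t) := by
    rw [hmap, chainLaw_succ_map_fst, integral_comp_measure _ _ hV hC]
  have h1 := hasSum_integral_occupancy M P π (hI1 _)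
  have h2 := (hasSum_integral_occupancy M P π (hI2 _)).mul_left M.γ
  -- By `hbs`, pushing the chain through `P` shifts time by one, so the two series cancel except for
  -- the time `0` term.
  rw [← hasSum_nat_add_iff' 1] at h1
  have h3 := h2.unique (by
    refine hasSum_of_eq h1 (fun t => ?_) rfl
    rw [← hbs]
    simp only [hb]
    ring)
  rw [integral_sub (hI1 _) ((hI2 _).const_mul _), integral_const_mul, h3, ← hb0]
  simp [hb]

lemma integral_occupancy {f : S × A → ℝ} (hf : Measurable f) {C : ℝ} (hC : ∀ x, |f x| ≤ C) :
    ∫ x, f x ∂(occupancy M P π) = ∫ s, ∑ a, π.prob s a * f (s, a) ∂(stateOccupancy M P π) := by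
  rw [← actKernel_comp_stateOccupancy, integral_comp_measure _ _ hf hC]
  simp_rw [integral_actKernel π _ hf]

/-- The performance difference between a policy in one model and another policy in another
model. -/
lemma value_sub_value (P' : Transition S A) (π' : Policy S A) :
    value M P π - value M P' π' = (1 - M.γ)⁻¹ *
      (M.γ * ∫ x, (∫ s, Vfun M P' π' s ∂(P.1 x) - ∫ s, Vfun M P' π' s ∂(P'.1 x)) ∂(occupancy M P π)
        + ∫ s, ∑ a, (π.prob s a - π'.prob s a) * Qfun M P' π' s a ∂(stateOccupancy M P π)) := by
  have hmV := measurable_Vfun M P' π'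
  have hbV := abs_Vfun_le M P' π'
  have hmQ := measurable_Qfun M P' π'
  have hI1 : Integrable (fun x : S × A => Vfun M P' π' x.1) (occupancy M P π) :=
    integrable_of_bounded _ (hmV.comp measurable_fst) fun x => hbV x.1
  have hIQ : Integrable (fun x : S × A => Qfun M P' π' x.1 x.2) (occupancy M P π) :=
    integrable_of_bounded _ hmQ fun x => abs_Qfun_le M P' π' x.1 x.2
  have hI2 (P'' : Transition S A) := integrable_transition hmV hbV P'' (occupancy M P π)
  have hr : Integrable M.r (occupancy M P π) :=
    integrable_of_bounded _ M.measurable_r (abs_reward_le M)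
  -- The flow equation of the first pair is applied to the value function of the second. This writes
  -- `value M P' π'` as an integral over the occupancy of `(P, π)`.
  have hflow := integral_flow M P π hmV hbV
  have hB : ∫ x, Qfun M P' π' x.1 x.2 ∂(occupancy M P π) =
      ∫ x, M.r x ∂(occupancy M P π) +
        M.γ * ∫ x, ∫ s, Vfun M P' π' s ∂(P'.1 x) ∂(occupancy M P π) := by
    simp_rw [Qfun_eq]
    rw [integral_add hr ((hI2 P').const_mul _), integral_const_mul]
  -- Since `V'` is the `π'`-average of `Q'`, the left integrand is the `π`-average of the advantage
  -- `Q' - V'`.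
  have hA : ∫ s, ∑ a, (π.prob s a - π'.prob s a) * Qfun M P' π' s a ∂(stateOccupancy M P π) =
      ∫ x, Qfun M P' π' x.1 x.2 ∂(occupancy M P π) -
        ∫ x, Vfun M P' π' x.1 ∂(occupancy M P π) := by
    rw [← integral_sub hIQ hI1, integral_occupancy M P π
      (f := fun x => Qfun M P' π' x.1 x.2 - Vfun M P' π' x.1) (C := (1 - M.γ)⁻¹ + (1 - M.γ)⁻¹)
      (hmQ.sub (hmV.comp measurable_fst))
      fun x => (abs_sub _ _).trans (add_le_add (abs_Qfun_le M P' π' x.1 x.2) (hbV x.1))]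
    refine integral_congr_ae (.of_forall fun s => ?_)
    simp only [sub_mul, mul_sub, Finset.sum_sub_distrib, ← Finset.sum_mul, (π.mem_simplex s).2,
      one_mul, Vfun_eq_sum]
  rw [integral_sub hI1 ((hI2 P).const_mul _), integral_const_mul] at hflow
  rw [hA, hB, integral_sub (hI2 P) (hI2 P'), value_eq]
  have h1 : value M P' π' = (1 - M.γ)⁻¹ * ((1 - M.γ) * ∫ s, Vfun M P' π' s ∂M.μ₀) := by
    rw [inv_mul_cancel_left₀ M.one_sub_pos.ne']; rfl
  rw [h1, ← hflow]
  ring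

end Bellman

/-! ### Density ratios and the `L¹` distance -/

section Measures

variable {X : Type*} [MeasurableSpace X]

/-- The infimum is attained: on each fixed set the inequality passes to the limit along admissible
constants. -/
lemma le_densitySup_smul {ν μ : Measure X} [IsFiniteMeasure μ] (h : densitySup ν μ < ∞) :
    ν ≤ densitySup ν μ • μ := by
  refine Measure.le_iff.2 fun E _ => ?_
  rw [Measure.smul_apply, smul_eq_mul]
  refine ENNReal.le_of_forall_pos_le_add fun ε hε _ => ?_
  -- The summand `1` keeps the denominator positive when `μ E = 0`.
  have hpos : (0 : ℝ≥0∞) < ε / (μ E + 1) :=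
    ENNReal.div_pos (by exact_mod_cast hε.ne') (by finiteness)
  obtain ⟨c, hc, hlt⟩ := sInf_lt_iff.1 (ENNReal.lt_add_right h.ne hpos.ne')
  have h1 : ν E ≤ c * μ E := by simpa using hc E
  refine h1.trans ((mul_le_mul_left hlt.le _).trans ?_)
  rw [add_mul]
  refine add_le_add_right ?_ _
  calc ε / (μ E + 1) * μ E ≤ ε / (μ E + 1) * (μ E + 1) := by gcongr; exact le_self_add
    _ = ε := ENNReal.div_mul_cancel (by simp) (by finiteness)

lemma ofReal_integral_le_lintegral {μ : Measure X} {f : X → ℝ} (hf : Integrable f μ) :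
    ENNReal.ofReal (∫ x, f x ∂μ) ≤ ∫⁻ x, ENNReal.ofReal (f x) ∂μ := by
  rw [integral_eq_lintegral_pos_part_sub_lintegral_neg_part hf]
  refine (ENNReal.ofReal_le_ofReal (sub_le_self _ ENNReal.toReal_nonneg)).trans
    ENNReal.ofReal_toReal_le

/-- With `J` the Jordan decomposition of `ν - μ`, one has `ν + J⁻ = μ + J⁺`. As `V` is nonnegative,
the difference of integrals is at most `∫ V ∂J⁻`, and `J⁻` is part of the total variation. -/
lemma ofReal_integral_sub_le (μ ν : Measure X) [IsFiniteMeasure μ] [IsFiniteMeasure ν]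
    {V : X → ℝ} (hV : Measurable V) {K : ℝ} (hK : ∀ x, V x ∈ Set.Icc 0 K) :
    ENNReal.ofReal (∫ x, V x ∂μ - ∫ x, V x ∂ν) ≤ ENNReal.ofReal K * l1dist ν μ := by
  set J := (ν.toSignedMeasure - μ.toSignedMeasure).toJordanDecomposition with hJ
  have hJs : J.posPart.toSignedMeasure - J.negPart.toSignedMeasure =
      ν.toSignedMeasure - μ.toSignedMeasure :=
    SignedMeasure.toSignedMeasure_toJordanDecomposition _
  have hsum : ν + J.negPart = μ + J.posPart := by
    rw [← Measure.toSignedMeasure_eq_toSignedMeasure_iff, Measure.toSignedMeasure_add,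
      Measure.toSignedMeasure_add, ← sub_eq_zero]
    rw [← sub_eq_zero] at hJs
    rw [← neg_eq_zero, ← hJs]
    abel
  have hb (x : X) : |V x| ≤ K := by rw [abs_of_nonneg (hK x).1]; exact (hK x).2
  have hI (m : Measure X) [IsFiniteMeasure m] : Integrable V m := integrable_of_bounded m hV hb
  have h1 := congrArg (fun m => ∫ x, V x ∂m) hsum
  simp only [integral_add_measure (hI _) (hI _)] at h1
  have h2 : ∫ x, V x ∂μ - ∫ x, V x ∂ν ≤ ∫ x, V x ∂J.negPart := by
    have : 0 ≤ ∫ x, V x ∂J.posPart := integral_nonneg fun x => (hK x).1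
    linarith
  calc ENNReal.ofReal (∫ x, V x ∂μ - ∫ x, V x ∂ν)
      ≤ ENNReal.ofReal (∫ x, V x ∂J.negPart) := ENNReal.ofReal_le_ofReal h2
    _ ≤ ∫⁻ x, ENNReal.ofReal (V x) ∂J.negPart := ofReal_integral_le_lintegral (hI _)
    _ ≤ ∫⁻ _, ENNReal.ofReal K ∂J.negPart :=
        lintegral_mono fun x => ENNReal.ofReal_le_ofReal (hK x).2
    _ = ENNReal.ofReal K * J.negPart Set.univ := lintegral_const _
    _ ≤ ENNReal.ofReal K * l1dist ν μ := by
        gcongr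
        rw [l1dist, SignedMeasure.totalVariation, ← hJ, Measure.add_apply]
        exact le_add_self

end Measures

/-! ### Model error and change of measure -/

section Gap

variable {S A : Type*} [MeasurableSpace S] [Fintype A] [MeasurableSpace A]
  [MeasurableSingletonClass A] (M : MDP S A)

/-- The model error term of the performance difference. -/
lemma ofReal_modelError_le (P P' : Transition S A) (π π' : Policy S A) (ρ : Measure (S × A))
    [IsFiniteMeasure ρ] (hρ : densitySup (occupancy M P π) ρ < ∞) (C : Set (Transition S A))
    (hP' : P' ∈ C) :
    ENNReal.ofReal (∫ x, (∫ s, Vfun M P' π' s ∂(P.1 x) - ∫ s, Vfun M P' π' s ∂(P'.1 x))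
      ∂(occupancy M P π)) ≤
    ENNReal.ofReal (1 - M.γ)⁻¹ * (densitySup (occupancy M P π) ρ * epsEst ρ P C) := by
  have hmV := measurable_Vfun M P' π'
  have hbV := abs_Vfun_le M P' π'
  refine (ofReal_integral_le_lintegral ((integrable_transition hmV hbV P _).sub
    (integrable_transition hmV hbV P' _))).trans ?_
  calc _ ≤ ∫⁻ x, ENNReal.ofReal (1 - M.γ)⁻¹ * l1dist (P'.1 x) (P.1 x) ∂(occupancy M P π) :=
        lintegral_mono fun x => ofReal_integral_sub_le (P.1 x) (P'.1 x) hmV (Vfun_mem M P' π')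
    _ = ENNReal.ofReal (1 - M.γ)⁻¹ * ∫⁻ x, l1dist (P'.1 x) (P.1 x) ∂(occupancy M P π) :=
        lintegral_const_mul' _ _ ENNReal.ofReal_ne_top
    _ ≤ ENNReal.ofReal (1 - M.γ)⁻¹ *
          ∫⁻ x, l1dist (P'.1 x) (P.1 x) ∂(densitySup (occupancy M P π) ρ • ρ) := by
        gcongr
        exact le_densitySup_smul hρ
    _ ≤ _ := by
        rw [lintegral_smul_measure, smul_eq_mul]
        gcongr
        exact le_iSup₂ (f := fun (Q : Transition S A) (_ : Q ∈ C) =>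
          ∫⁻ x, l1dist (Q.1 x) (P.1 x) ∂ρ) P' hP'

/-- Change of measure from the comparator to the sampling distribution of a rollout. -/
lemma lintegral_enorm_le_eLpNorm (P P' : Transition S A) (π π' : Policy S A)
    (h : densitySup (stateOccupancy M P π) M.μ₀ < ∞) {e : S → ℝ} (he : Measurable e) :
    ∫⁻ s, ‖e s‖ₑ ∂(stateOccupancy M P π) ≤
      (densitySup (stateOccupancy M P π) M.μ₀ * ENNReal.ofReal (1 - M.γ)⁻¹) ^ (1 / 2 : ℝ) *
        eLpNorm e 2 (stateOccupancy M P' π') := by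
  set κ := densitySup (stateOccupancy M P π) M.μ₀
  -- The initial distribution links the two occupancies: every occupancy dominates `(1 - γ) μ₀`,
  -- whatever the model and the policy.
  have h1 : M.μ₀ ≤ ENNReal.ofReal (1 - M.γ)⁻¹ • stateOccupancy M P' π' := by
    refine Measure.le_iff.2 fun E _ => ?_
    have h0 : ENNReal.ofReal (1 - M.γ) * M.μ₀ E ≤ stateOccupancy M P' π' E := by
      simpa using initial_le_stateOccupancy M P' π' E
    calc M.μ₀ E = ENNReal.ofReal (1 - M.γ)⁻¹ * (ENNReal.ofReal (1 - M.γ) * M.μ₀ E) := by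
          rw [← mul_assoc, ← ENNReal.ofReal_mul (inv_nonneg.2 M.one_sub_pos.le),
            inv_mul_cancel₀ M.one_sub_pos.ne', ENNReal.ofReal_one, one_mul]
      _ ≤ _ := by rw [Measure.smul_apply, smul_eq_mul]; gcongr
  have h2 : stateOccupancy M P π ≤ (κ * ENNReal.ofReal (1 - M.γ)⁻¹) • stateOccupancy M P' π' := by
    refine (le_densitySup_smul h).trans ?_
    rw [mul_smul]
    refine Measure.le_iff.2 fun E _ => ?_
    rw [Measure.smul_apply, Measure.smul_apply, smul_eq_mul, smul_eq_mul]
    gcongr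
  calc ∫⁻ s, ‖e s‖ₑ ∂(stateOccupancy M P π)
      = eLpNorm e 1 (stateOccupancy M P π) := eLpNorm_one_eq_lintegral_enorm.symm
    _ ≤ eLpNorm e 2 (stateOccupancy M P π) :=
        eLpNorm_le_eLpNorm_of_exponent_le (by norm_num) he.aestronglyMeasurable
    _ ≤ eLpNorm e 2 ((κ * ENNReal.ofReal (1 - M.γ)⁻¹) • stateOccupancy M P' π') :=
        eLpNorm_mono_measure _ h2
    _ = _ := by
        rw [eLpNorm_smul_measure_of_ne_top (by norm_num), smul_eq_mul]
        norm_num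

end Gap

/-! ### Second moments and Monte Carlo rollouts -/

section SecondMoment

variable {X : Type*} [MeasurableSpace X] {μ : Measure X}

lemma memLp_two_of_lintegral_sq {f : X → ℝ} (hf : Measurable f)
    (h : ∫⁻ x, ENNReal.ofReal (f x ^ 2) ∂μ < ∞) : MemLp f 2 μ := by
  rw [memLp_two_iff_integrable_sq hf.aestronglyMeasurable]
  refine ⟨(hf.pow_const 2).aestronglyMeasurable, ?_⟩
  rw [hasFiniteIntegral_iff_ofReal (.of_forall fun x => sq_nonneg _)]
  exact h

lemma integral_sq_le_of_lintegral {f : X → ℝ} (hf : Measurable f) {c : ℝ} (hc : 0 ≤ c)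
    (h : ∫⁻ x, ENNReal.ofReal (f x ^ 2) ∂μ ≤ ENNReal.ofReal c) : ∫ x, f x ^ 2 ∂μ ≤ c := by
  rw [integral_eq_lintegral_of_nonneg_ae (.of_forall fun x => sq_nonneg _)
    (hf.pow_const 2).aestronglyMeasurable]
  exact ENNReal.toReal_le_of_le_ofReal hc h

end SecondMoment

section Rollout

variable {S A : Type*} [MeasurableSpace S] [Fintype A] [MeasurableSpace A]
  [MeasurableSingletonClass A] (M : MDP S A)

lemma stopProb_ne_zero : stopProb M ≠ 0 := by
  intro h
  have := congrArg Subtype.val h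
  exact M.one_sub_pos.ne' this

/-- The undiscounted sum of the first `k + 1` rewards. -/
def rewardSum (k : ℕ) (x : ℕ → S × A) : ℝ := ∑ h ∈ Finset.range (k + 1), M.r (x h)

lemma rewardSum_nonneg (k : ℕ) (x : ℕ → S × A) : 0 ≤ rewardSum M k x :=
  Finset.sum_nonneg fun _ _ => (M.r_mem _).1

lemma rewardSum_le (k : ℕ) (x : ℕ → S × A) : rewardSum M k x ≤ k + 1 := by
  calc rewardSum M k x ≤ ∑ _h ∈ Finset.range (k + 1), (1 : ℝ) :=
        Finset.sum_le_sum fun _ _ => (M.r_mem _).2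
    _ = k + 1 := by simp

/-- Through `succ_sq_le` this series dominates that of `(k + 1) ^ 2 γ ^ k`. -/
lemma hasSum_succ_sq_bound :
    HasSum (fun k : ℕ => (((k + 2).choose 2 : ℕ) : ℝ) * M.γ ^ k) (1 / (1 - M.γ) ^ 3) := by
  refine hasSum_choose_mul_geometric_of_norm_lt_one 2 ?_
  rw [Real.norm_eq_abs, abs_of_nonneg M.γ_mem.1]
  exact M.γ_mem.2

lemma succ_sq_le (k : ℕ) : ((k : ℝ) + 1) ^ 2 ≤ 2 * (((k + 2).choose 2 : ℕ) : ℝ) := by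
  rw [Nat.cast_choose_two]
  push_cast
  nlinarith [(Nat.cast_nonneg k : (0 : ℝ) ≤ k)]

/-- The second moment of the number of rewards in a rollout. The stopping probability `1 - γ` lowers
the power `3` of the dominating series to `2`. -/
lemma lintegral_geometric_succ_sq :
    ∫⁻ k : ℕ, ENNReal.ofReal (((k : ℝ) + 1) ^ 2) ∂(geometricMeasure (stopProb M)) ≤
      ENNReal.ofReal (2 / (1 - M.γ) ^ 2) := by
  have hs := (hasSum_succ_sq_bound M).mul_left (2 * (1 - M.γ))
  have h0 := M.one_sub_pos
  have hγ := M.γ_mem.1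
  rw [geometricMeasure_eq (stopProb_ne_zero M), lintegral_sum_measure]
  have hval : 2 * (1 - M.γ) * (1 / (1 - M.γ) ^ 3) = 2 / (1 - M.γ) ^ 2 := by field_simp
  rw [← hval, ← hs.tsum_eq, ENNReal.ofReal_tsum_of_nonneg (fun k => by positivity) hs.summable]
  refine ENNReal.tsum_le_tsum fun k => ?_
  rw [lintegral_smul_measure, lintegral_dirac, smul_eq_mul,
    ← ENNReal.ofReal_mul (geometricMeasure_nonneg _ k)]
  refine ENNReal.ofReal_le_ofReal ?_
  have h1 : ((stopProb M : unitInterval) : ℝ) = 1 - M.γ := rfl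
  rw [h1, sub_sub_cancel]
  have := mul_le_mul_of_nonneg_left (succ_sq_le k)
    (mul_nonneg (pow_nonneg hγ k) h0.le)
  linarith

/-- Geometric stopping replaces discounting: the reward at time `h` is collected exactly when the
rollout survives until `h`, which has probability `γ ^ h`. -/
lemma integral_geometric_rewardSum (x : ℕ → S × A) :
    ∫ k, rewardSum M k x ∂(geometricMeasure (stopProb M)) = discountedReturn M x := by
  have h0 := M.one_sub_pos
  have hγ := M.γ_mem.1
  have hsum : Summable fun k => M.γ ^ k * rewardSum M k x := by
    refine ((hasSum_succ_sq_bound M).mul_left 2).summable.of_nonneg_of_le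
      (fun k => mul_nonneg (pow_nonneg hγ k) (rewardSum_nonneg M k x)) fun k => ?_
    have h1 := rewardSum_le M k x
    have h2 := succ_sq_le k
    have h3 : rewardSum M k x ≤ 2 * (((k + 2).choose 2 : ℕ) : ℝ) := by
      nlinarith [(Nat.cast_nonneg k : (0 : ℝ) ≤ k)]
    have := mul_le_mul_of_nonneg_left h3 (pow_nonneg hγ k)
    linarith
  have hR := (summable_discounted M x).hasSum
  have hS := hsum.hasSum
  have hR1 := (hasSum_nat_add_iff' 1).2 hR
  have hS1 := (hasSum_nat_add_iff' 1).2 hS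
  -- Summation by parts: if `S` is the series of `γ ^ k` times the partial sums and `R` the
  -- discounted return, shifting the index gives `S = γ S + R`.
  have h2 := hS1.unique (hasSum_of_eq ((hS.mul_left M.γ).add hR1) (fun k => by
    simp only [rewardSum, Finset.sum_range_succ _ (k + 1)]
    ring) rfl)
  have h3 : (∑' k, M.γ ^ k * rewardSum M k x) * (1 - M.γ) = discountedReturn M x := by
    simp only [rewardSum, Finset.range_one, Finset.sum_singleton, pow_zero, one_mul, zero_add,
      discountedReturn] at h2 ⊢
    linarith
  rw [integral_geometricMeasure (stopProb_ne_zero M), ← h3, ← tsum_mul_right]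
  refine tsum_congr fun k => ?_
  have h1 : ((stopProb M : unitInterval) : ℝ) = 1 - M.γ := rfl
  rw [h1, sub_sub_cancel, smul_eq_mul]
  ring

variable (P : Transition S A) (π : Policy S A) (a : A)

lemma rolloutKernel_apply (s : S) :
    rolloutKernel M P π a s = ((geometricMeasure (stopProb M)).prod
      (trajKernel P π (s, a))).map fun y => rewardSum M y.1 y.2 := by
  rw [rolloutKernel, Kernel.map_apply _ (measurable_rolloutSum M), Kernel.prod_apply,
    Kernel.const_apply, Kernel.comap_apply]
  rfl

lemma lintegral_rewardSum_sq (τ : Measure (ℕ → S × A)) [IsProbabilityMeasure τ] :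
    ∫⁻ y, ENNReal.ofReal (rewardSum M y.1 y.2 ^ 2) ∂((geometricMeasure (stopProb M)).prod τ) ≤
      ENNReal.ofReal (2 / (1 - M.γ) ^ 2) := by
  have hm : Measurable fun y : ℕ × (ℕ → S × A) => rewardSum M y.1 y.2 := measurable_rolloutSum M
  rw [lintegral_prod _ (hm.pow_const 2).ennreal_ofReal.aemeasurable]
  refine le_trans (lintegral_mono fun k => ?_) (lintegral_geometric_succ_sq M)
  calc ∫⁻ x, ENNReal.ofReal (rewardSum M k x ^ 2) ∂τ
      ≤ ∫⁻ _, ENNReal.ofReal (((k : ℝ) + 1) ^ 2) ∂τ :=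
        lintegral_mono fun x => ENNReal.ofReal_le_ofReal
          (pow_le_pow_left₀ (rewardSum_nonneg M k x) (rewardSum_le M k x) 2)
    _ = _ := by simp

lemma lintegral_rollout_sq (s : S) :
    ∫⁻ q, ENNReal.ofReal (q ^ 2) ∂(rolloutKernel M P π a s) ≤
      ENNReal.ofReal (2 / (1 - M.γ) ^ 2) := by
  have hm : Measurable fun y : ℕ × (ℕ → S × A) => rewardSum M y.1 y.2 := measurable_rolloutSum M
  rw [rolloutKernel_apply, lintegral_map (by fun_prop) hm]
  exact lintegral_rewardSum_sq M _

lemma memLp_rollout (s : S) : MemLp (fun q : ℝ => q) 2 (rolloutKernel M P π a s) :=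
  memLp_two_of_lintegral_sq measurable_id
    ((lintegral_rollout_sq M P π a s).trans_lt ENNReal.ofReal_lt_top)

/-- A rollout is an unbiased estimate of the action-value function. -/
lemma integral_rollout (s : S) :
    ∫ q, q ∂(rolloutKernel M P π a s) = Qfun M P π s a := by
  have hm : Measurable fun y : ℕ × (ℕ → S × A) => rewardSum M y.1 y.2 := measurable_rolloutSum M
  rw [rolloutKernel_apply, integral_map (f := fun q : ℝ => q) hm.aemeasurable
    measurable_id.aestronglyMeasurable]
  have hI : Integrable (fun y : ℕ × (ℕ → S × A) => rewardSum M y.1 y.2)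
      ((geometricMeasure (stopProb M)).prod (trajKernel P π (s, a))) :=
    (memLp_two_of_lintegral_sq hm
      ((lintegral_rewardSum_sq M _).trans_lt ENNReal.ofReal_lt_top)).integrable (by norm_num)
  rw [integral_prod_symm _ hI]
  simp_rw [integral_geometric_rewardSum]
  rfl

lemma integral_rollout_sub_sq_le (s : S) :
    ∫ q, (q - Qfun M P π s a) ^ 2 ∂(rolloutKernel M P π a s) ≤ 2 / (1 - M.γ) ^ 2 := by
  have h0 := M.one_sub_pos
  have h1 := variance_le_expectation_sq (μ := rolloutKernel M P π a s)
    (X := fun q : ℝ => q) measurable_id.aestronglyMeasurable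
  rw [variance_eq_integral (X := fun q : ℝ => q) measurable_id.aemeasurable,
    integral_rollout] at h1
  exact h1.trans (integral_sq_le_of_lintegral measurable_id (by positivity)
    (lintegral_rollout_sq M P π a s))

end Rollout

/-! ### Moments of empirical means -/

section EmpiricalMean

variable {X : Type*} [MeasurableSpace X]

/-- The average of a function over a sample. -/
def empMean {N : ℕ} (Y : X → ℝ) (x : Fin N → X) : ℝ := (N : ℝ)⁻¹ * ∑ j, Y (x j)

lemma measurable_empMean {N : ℕ} {Y : X → ℝ} (hY : Measurable Y) :
    Measurable (empMean (N := N) Y) := by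
  unfold empMean
  fun_prop

lemma lintegral_ofReal_empMean (μ : Measure X) [IsProbabilityMeasure μ] {N : ℕ} (hN : 0 < N)
    {Y : X → ℝ} (hY : Measurable Y) (h0 : ∀ x, 0 ≤ Y x) :
    ∫⁻ x, ENNReal.ofReal (empMean Y x) ∂(Measure.pi fun _ : Fin N => μ) =
      ∫⁻ x, ENNReal.ofReal (Y x) ∂μ := by
  have hj (j : Fin N) : ∫⁻ x : Fin N → X, ENNReal.ofReal (Y (x j)) ∂(Measure.pi fun _ => μ) =
      ∫⁻ x, ENNReal.ofReal (Y x) ∂μ :=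
    (measurePreserving_eval (fun _ : Fin N => μ) j).lintegral_comp hY.ennreal_ofReal
  have hNR : (0 : ℝ) < N := by exact_mod_cast hN
  have h1 (x : Fin N → X) : ENNReal.ofReal (empMean Y x) =
      ENNReal.ofReal (N : ℝ)⁻¹ * ∑ j, ENNReal.ofReal (Y (x j)) := by
    rw [empMean, ENNReal.ofReal_mul (by positivity),
      ENNReal.ofReal_sum_of_nonneg fun j _ => h0 _]
  simp_rw [h1]
  rw [lintegral_const_mul _ (by fun_prop), lintegral_finsetSum _ (by fun_prop)]
  simp only [hj, Finset.sum_const, Finset.card_univ, Fintype.card_fin, nsmul_eq_mul]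
  rw [← mul_assoc, ENNReal.ofReal_inv_of_pos hNR, ENNReal.ofReal_natCast,
    ENNReal.inv_mul_cancel (by exact_mod_cast hN.ne') (by simp), one_mul]

/-- Independence divides the variance by `N`, and the variance is at most the second moment. No tail
assumption enters, as required by unbounded rollouts. -/
lemma lintegral_empMean_sub_sq_le (μ : Measure X) [IsProbabilityMeasure μ] {N : ℕ} (hN : 0 < N)
    {Y : X → ℝ} (hY : Measurable Y) (hL : MemLp Y 2 μ) :
    ∫⁻ x, ENNReal.ofReal ((empMean Y x - ∫ z, Y z ∂μ) ^ 2) ∂(Measure.pi fun _ : Fin N => μ) ≤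
      ENNReal.ofReal ((∫ z, Y z ^ 2 ∂μ) / N) := by
  have hNR : (0 : ℝ) < N := by exact_mod_cast hN
  set ν := Measure.pi fun _ : Fin N => μ with hν
  have hmp (j : Fin N) := measurePreserving_eval (fun _ : Fin N => μ) j
  have hLj (j : Fin N) : MemLp (fun x : Fin N → X => Y (x j)) 2 ν :=
    hL.comp_measurePreserving (hmp j)
  have hIj (j : Fin N) : ∫ x : Fin N → X, Y (x j) ∂ν = ∫ z, Y z ∂μ := by
    rw [← (hmp j).map_eq, integral_map (hmp j).measurable.aemeasurable hY.aestronglyMeasurable]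
  have hLm : MemLp (empMean (N := N) Y) 2 ν :=
    (memLp_finsetSum Finset.univ fun j _ => hLj j).const_mul (N : ℝ)⁻¹
  have hmean : ∫ x, empMean Y x ∂ν = ∫ z, Y z ∂μ := by
    unfold empMean
    rw [integral_const_mul, integral_finsetSum _ fun j _ => (hLj j).integrable (by norm_num)]
    simp only [hIj, Finset.sum_const, Finset.card_univ, Fintype.card_fin, nsmul_eq_mul]
    rw [inv_mul_cancel_left₀ hNR.ne']
  have hvar : Var[empMean (N := N) Y; ν] ≤ (∫ z, Y z ^ 2 ∂μ) / N := by
    have h1 : (empMean (N := N) Y) =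
        fun x => (N : ℝ)⁻¹ * (∑ j, fun x : Fin N → X => Y (x j)) x := by
      funext x
      simp [empMean]
    rw [h1, variance_const_mul, hν, variance_sum_pi fun _ => hL]
    simp only [Finset.sum_const, Finset.card_univ, Fintype.card_fin, nsmul_eq_mul]
    have h2 : Var[Y; μ] ≤ ∫ z, Y z ^ 2 ∂μ := variance_le_expectation_sq hL.aestronglyMeasurable
    calc (N : ℝ)⁻¹ ^ 2 * (N * Var[Y; μ]) = Var[Y; μ] / N := by field_simp
      _ ≤ _ := by gcongr
  rw [variance_eq_integral (measurable_empMean hY).aemeasurable, hmean] at hvar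
  rw [← ofReal_integral_eq_lintegral_ofReal _ (.of_forall fun x => sq_nonneg _)]
  · exact ENNReal.ofReal_le_ofReal hvar
  · exact (hLm.sub (memLp_const _)).integrable_sq

end EmpiricalMean

/-! ### Least squares over a finite class -/

section Regression

variable {S : Type*} [MeasurableSpace S]

/-- The deterministic core of the regression bound. Here `ξ` is the noise, `u` the target minus the
reference function, `h` the fitted minus the reference function, and `v` the population counterpart
of `Z`. Dividing the fluctuations by `v` makes their expectations independent of the size of `h`. -/
lemma regression_basic {N : ℕ} (hN : 0 < N) {ξ u h : Fin N → ℝ} {v X Y Z : ℝ} (hv : 0 < v)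
    (hX : X = (N : ℝ)⁻¹ * ∑ j, u j ^ 2) (hY : Y = (N : ℝ)⁻¹ * ∑ j, ξ j * h j)
    (hZ : Z = (N : ℝ)⁻¹ * ∑ j, h j ^ 2)
    (hle : (N : ℝ)⁻¹ * ∑ j, (ξ j + u j - h j) ^ 2 ≤ (N : ℝ)⁻¹ * ∑ j, (ξ j + u j) ^ 2) :
    v ≤ 16 * X + (64 * (Y ^ 2 / v) + 2 * ((Z - v) ^ 2 / v)) := by
  have hNR : (0 : ℝ) < (N : ℝ)⁻¹ := by have : (0 : ℝ) < N := by exact_mod_cast hN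
                                       positivity
  have h1 : Z ≤ 4 * X + 4 * Y := by
    have h2 : ∑ j, (ξ j + u j - h j) ^ 2 ≤ ∑ j, (ξ j + u j) ^ 2 := le_of_mul_le_mul_left hle hNR
    have h3 : ∑ j, h j ^ 2 ≤ 4 * ∑ j, u j ^ 2 + 4 * ∑ j, ξ j * h j := by
      -- The cross term is split by `2 u h ≤ 2 u ^ 2 + h ^ 2 / 2`, which leaves half of `h ^ 2` on
      -- the other side.
      have h4 : ∑ j, (ξ j + u j) ^ 2 - ∑ j, (ξ j + u j - h j) ^ 2 ≤
          ∑ j, (2 * (ξ j * h j) + 2 * u j ^ 2 - h j ^ 2 / 2) := by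
        rw [← Finset.sum_sub_distrib]
        exact Finset.sum_le_sum fun j _ => by nlinarith [sq_nonneg (2 * u j - h j)]
      simp only [Finset.sum_sub_distrib, Finset.sum_add_distrib, ← Finset.mul_sum,
        ← Finset.sum_div] at h4
      linarith
    rw [hX, hY, hZ]
    have := mul_le_mul_of_nonneg_left h3 hNR.le
    linarith
  have h5 : v - 2 * Z ≤ (Z - v) ^ 2 / v := by
    rw [le_div_iff₀ hv]
    nlinarith [sq_nonneg Z]
  -- The noise term is allowed to use up half of `v`; the final doubling produces `16`, `64` and
  -- `2`.
  have h6 : 8 * Y - v / 2 ≤ 32 * (Y ^ 2 / v) := by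
    rw [← mul_div_assoc, le_div_iff₀ hv]
    nlinarith [sq_nonneg (8 * Y - v)]
  linarith

variable (d : Measure S) [IsProbabilityMeasure d] (κ : Kernel S ℝ) [IsMarkovKernel κ]
  {m : S → ℝ} {σ2 : ℝ}

/-- The regression noise weighted by a function of the design point. -/
lemma weightedNoise_moments (hm : Measurable m) (hσ : 0 ≤ σ2)
    (hL : ∀ s, MemLp (fun q : ℝ => q) 2 (κ s)) (hmean : ∀ s, ∫ q, q ∂κ s = m s)
    (hvar : ∀ s, ∫ q, (q - m s) ^ 2 ∂κ s ≤ σ2) {h : S → ℝ} (hh : Measurable h) {K : ℝ}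
    (hK : ∀ s, |h s| ≤ K) :
    MemLp (fun z : S × ℝ => (z.2 - m z.1) * h z.1) 2 (d ⊗ₘ κ) ∧
    ∫ z, (z.2 - m z.1) * h z.1 ∂(d ⊗ₘ κ) = 0 ∧
    ∫ z, ((z.2 - m z.1) * h z.1) ^ 2 ∂(d ⊗ₘ κ) ≤ σ2 * ∫ s, h s ^ 2 ∂d := by
  have hLs (s : S) : MemLp (fun q : ℝ => q - m s) 2 (κ s) := (hL s).sub (memLp_const _)
  have hY : Measurable fun z : S × ℝ => (z.2 - m z.1) * h z.1 := by fun_prop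
  have hIh : Integrable (fun s => h s ^ 2) d :=
    integrable_of_bounded d (hh.pow_const 2) (C := K ^ 2) fun s => by
      rw [abs_pow]; exact pow_le_pow_left₀ (abs_nonneg _) (hK s) 2
  -- Conditioning on the design point inside a lower integral makes square integrability a
  -- consequence of the bound.
  have h2 : ∫⁻ z, ENNReal.ofReal (((z.2 - m z.1) * h z.1) ^ 2) ∂(d ⊗ₘ κ) ≤
      ENNReal.ofReal (σ2 * ∫ s, h s ^ 2 ∂d) := by
    rw [Measure.lintegral_compProd (hY.pow_const 2).ennreal_ofReal, ← integral_const_mul,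
      ofReal_integral_eq_lintegral_ofReal (hIh.const_mul _)
        (.of_forall fun s => mul_nonneg hσ (sq_nonneg _))]
    refine lintegral_mono fun s => ?_
    simp only [mul_pow]
    rw [← ofReal_integral_eq_lintegral_ofReal ((hLs s).integrable_sq.mul_const _)
      (.of_forall fun q => mul_nonneg (sq_nonneg _) (sq_nonneg _)), integral_mul_const]
    exact ENNReal.ofReal_le_ofReal (mul_le_mul_of_nonneg_right (hvar s) (sq_nonneg _))
  have hM := memLp_two_of_lintegral_sq hY (h2.trans_lt ENNReal.ofReal_lt_top)
  refine ⟨hM, ?_, integral_sq_le_of_lintegral hY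
    (mul_nonneg hσ (integral_nonneg fun s => sq_nonneg _)) h2⟩
  rw [Measure.integral_compProd (hM.integrable (by norm_num))]
  simp only [integral_mul_const]
  have h3 (s : S) : ∫ q, (q - m s) ∂κ s = 0 := by
    rw [integral_sub ((hL s).integrable (by norm_num)) (integrable_const _), hmean]
    simp
  simp [h3]

/-- Expected squared error of empirical risk minimization over a finite class of bounded
functions, in the form of a pathwise bound by a function of the sample. -/
theorem exists_regression_bound (hm : Measurable m) (hσ : 0 ≤ σ2)
    (hL : ∀ s, MemLp (fun q : ℝ => q) 2 (κ s)) (hmean : ∀ s, ∫ q, q ∂κ s = m s)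
    (hvar : ∀ s, ∫ q, (q - m s) ^ 2 ∂κ s ≤ σ2) {g : S → ℝ} (hg : Measurable g)
    {B : ℝ} (F : Finset (S → ℝ)) (hF : ∀ f ∈ F, Measurable f ∧ ∀ s, |f s| ≤ B)
    {f₀ : S → ℝ} (hf₀ : f₀ ∈ F) {N : ℕ} (hN : 0 < N) :
    ∃ Ψ : (Fin N → S × ℝ) → ℝ≥0∞, Measurable Ψ ∧
      ∫⁻ x, Ψ x ∂(Measure.pi fun _ => d ⊗ₘ κ) ≤
        34 * ∫⁻ s, ENNReal.ofReal ((m s + g s - f₀ s) ^ 2) ∂d +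
          F.card * ENNReal.ofReal ((128 * σ2 + 16 * B ^ 2) / N) ∧
      ∀ x, ∀ f ∈ F,
        (N : ℝ)⁻¹ * ∑ j, ((x j).2 + g (x j).1 - f (x j).1) ^ 2 ≤
          (N : ℝ)⁻¹ * ∑ j, ((x j).2 + g (x j).1 - f₀ (x j).1) ^ 2 →
        ∫⁻ s, ENNReal.ofReal ((m s + g s - f s) ^ 2) ∂d ≤ Ψ x := by
  have hNR : (0 : ℝ) < N := by exact_mod_cast hN
  set μ := d ⊗ₘ κ with hμ
  obtain ⟨hm₀, hb₀⟩ := hF f₀ hf₀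
  set ε := ∫⁻ s, ENNReal.ofReal ((m s + g s - f₀ s) ^ 2) ∂d with hε
  set v : (S → ℝ) → ℝ := fun f => ∫ s, (f s - f₀ s) ^ 2 ∂d with hv
  set U : S × ℝ → ℝ := fun z => (m z.1 + g z.1 - f₀ z.1) ^ 2 with hU
  set Y : (S → ℝ) → S × ℝ → ℝ := fun f z => (z.2 - m z.1) * (f z.1 - f₀ z.1) with hYdef
  set Z : (S → ℝ) → S × ℝ → ℝ := fun f z => (f z.1 - f₀ z.1) ^ 2 with hZdef
  have hv0 (f) : 0 ≤ v f := integral_nonneg fun s => sq_nonneg _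
  have hUm : Measurable U := by fun_prop
  have hYm (f) (hf : f ∈ F) : Measurable (Y f) := by
    have := (hF f hf).1
    fun_prop
  have hZm (f) (hf : f ∈ F) : Measurable (Z f) := by
    have := (hF f hf).1
    fun_prop
  have hdm (f) (hf : f ∈ F) : Measurable fun s => f s - f₀ s := (hF f hf).1.sub hm₀
  have hdb (f) (hf : f ∈ F) (s) : |f s - f₀ s| ≤ 2 * B :=
    (abs_sub _ _).trans (by linarith [(hF f hf).2 s, hb₀ s])
  have hdb2 (f) (hf : f ∈ F) (s) : (f s - f₀ s) ^ 2 ≤ 4 * B ^ 2 := by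
    rw [← sq_abs]
    nlinarith [hdb f hf s, abs_nonneg (f s - f₀ s)]
  have hdI (f) (hf : f ∈ F) : Integrable (fun s => (f s - f₀ s) ^ 2) d :=
    integrable_of_bounded d ((hdm f hf).pow_const 2) (C := 4 * B ^ 2) fun s => by
      rw [abs_of_nonneg (sq_nonneg _)]; exact hdb2 f hf s
  have hfst : μ.map Prod.fst = d := by
    rw [hμ]; exact Measure.fst_compProd d κ
  have hint (φ : S → ℝ) (hφ : Measurable φ) : ∫ z, φ z.1 ∂μ = ∫ s, φ s ∂d := by
    rw [← hfst, integral_map measurable_fst.aemeasurable hφ.aestronglyMeasurable]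
  -- The normalized fluctuation attached to `f`. If `v f = 0` both quotients are `0` by convention,
  -- and `f` then needs no fluctuation bound.
  set R : (S → ℝ) → (Fin N → S × ℝ) → ℝ := fun f x =>
    64 * (empMean (Y f) x ^ 2 / v f) + 2 * ((empMean (Z f) x - v f) ^ 2 / v f) with hR
  have hR0 (f x) : 0 ≤ R f x := by have := hv0 f; positivity
  have hRm (f) (hf : f ∈ F) : Measurable (R f) := by
    have h1 := measurable_empMean (N := N) (hYm f hf)
    have h2 := measurable_empMean (N := N) (hZm f hf)
    exact (((h1.pow_const 2).div_const _).const_mul _).add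
      ((((h2.sub_const _).pow_const 2).div_const _).const_mul _)
  -- The second moments of `Y f` and `Z f` are at most `σ2 * v f` and `4 * B ^ 2 * v f`, so `v f`
  -- cancels.
  have hRint (f) (hf : f ∈ F) : ∫⁻ x, ENNReal.ofReal (R f x) ∂(Measure.pi fun _ => μ) ≤
      ENNReal.ofReal ((64 * σ2 + 8 * B ^ 2) / N) := by
    rcases (hv0 f).eq_or_lt with h0 | hpos
    · simp [hR, ← h0]
    obtain ⟨hYL, hYI, hYV⟩ := weightedNoise_moments d κ hm hσ hL hmean hvar (hdm f hf) (hdb f hf)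
    have hZb (z : S × ℝ) : ‖Z f z‖ ≤ 4 * B ^ 2 := by
      rw [Real.norm_of_nonneg (sq_nonneg _)]; exact hdb2 f hf z.1
    have hZL : MemLp (Z f) 2 μ :=
      MemLp.of_bound (hZm f hf).aestronglyMeasurable _ (.of_forall hZb)
    have hZI : ∫ z, Z f z ∂μ = v f := hint _ ((hdm f hf).pow_const 2)
    have hZV : ∫ z, Z f z ^ 2 ∂μ ≤ 4 * B ^ 2 * v f := by
      rw [← hZI, ← integral_const_mul]
      refine integral_mono hZL.integrable_sq ((hZL.integrable (by norm_num)).const_mul _)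
        fun z => ?_
      have h1 : Z f z ≤ 4 * B ^ 2 := hdb2 f hf z.1
      have h2 : 0 ≤ Z f z := sq_nonneg _
      simp only
      nlinarith
    have e1 := lintegral_empMean_sub_sq_le μ hN (hYm f hf) hYL
    have e2 := lintegral_empMean_sub_sq_le μ hN (hZm f hf) hZL
    rw [hYI] at e1
    rw [hZI] at e2
    simp only [sub_zero] at e1
    have hsplit (x) : ENNReal.ofReal (R f x) =
        ENNReal.ofReal (64 / v f) * ENNReal.ofReal (empMean (Y f) x ^ 2) +
        ENNReal.ofReal (2 / v f) * ENNReal.ofReal ((empMean (Z f) x - v f) ^ 2) := by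
      rw [← ENNReal.ofReal_mul (by positivity), ← ENNReal.ofReal_mul (by positivity),
        ← ENNReal.ofReal_add (by positivity) (by positivity)]
      congr 1
      simp only [hR]
      ring
    simp_rw [hsplit]
    have h1 := measurable_empMean (N := N) (hYm f hf)
    have h2 := measurable_empMean (N := N) (hZm f hf)
    rw [lintegral_add_left (by fun_prop), lintegral_const_mul _ (by fun_prop),
      lintegral_const_mul _ (by fun_prop)]
    calc _ ≤ ENNReal.ofReal (64 / v f) * ENNReal.ofReal (σ2 * v f / N) +
          ENNReal.ofReal (2 / v f) * ENNReal.ofReal (4 * B ^ 2 * v f / N) := by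
          gcongr
          · exact e1.trans (ENNReal.ofReal_le_ofReal (by gcongr))
          · exact e2.trans (ENNReal.ofReal_le_ofReal (by gcongr))
      _ = _ := by
          rw [← ENNReal.ofReal_mul (by positivity), ← ENNReal.ofReal_mul (by positivity),
            ← ENNReal.ofReal_add (by positivity) (by positivity)]
          congr 1
          field_simp
          ring
  -- Summing over the whole class makes the bound independent of the selected function; this is
  -- where the cardinality enters. The constant `34` is `2 + 2 * 16`.
  refine ⟨fun x => 2 * ε + 2 * (16 * ENNReal.ofReal (empMean U x) +
    ∑ f ∈ F, ENNReal.ofReal (R f x)), ?_, ?_, ?_⟩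
  · have h1 := measurable_empMean (N := N) hUm
    have h2 : Measurable fun x => ∑ f ∈ F, ENNReal.ofReal (R f x) :=
      Finset.measurable_fun_sum _ fun f hf => (hRm f hf).ennreal_ofReal
    fun_prop
  · have h1 := measurable_empMean (N := N) hUm
    have h2 : Measurable fun x => ∑ f ∈ F, ENNReal.ofReal (R f x) :=
      Finset.measurable_fun_sum _ fun f hf => (hRm f hf).ennreal_ofReal
    have hUε : ∫⁻ z, ENNReal.ofReal (U z) ∂μ = ε := by
      rw [hε, ← hfst, lintegral_map (by fun_prop) measurable_fst]
    rw [lintegral_add_left (by fun_prop), lintegral_const, measure_univ, mul_one,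
      lintegral_const_mul _ (by fun_prop), lintegral_add_left (by fun_prop),
      lintegral_const_mul _ (by fun_prop), lintegral_ofReal_empMean μ hN hUm
      fun _ => sq_nonneg _, hUε,
      lintegral_finsetSum' _ fun f hf => (hRm f hf).ennreal_ofReal.aemeasurable]
    have h3 : ∑ f ∈ F, ∫⁻ x, ENNReal.ofReal (R f x) ∂(Measure.pi fun _ => μ) ≤
        F.card * ENNReal.ofReal ((64 * σ2 + 8 * B ^ 2) / N) := by
      rw [← nsmul_eq_mul]
      exact Finset.sum_le_card_nsmul _ _ _ hRint
    have h4 : ENNReal.ofReal ((128 * σ2 + 16 * B ^ 2) / N) =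
        2 * ENNReal.ofReal ((64 * σ2 + 8 * B ^ 2) / N) := by
      rw [← ENNReal.ofReal_ofNat 2, ← ENNReal.ofReal_mul (by norm_num)]
      congr 1
      ring
    rw [h4]
    calc _ ≤ 2 * ε + 2 * (16 * ε + F.card * ENNReal.ofReal ((64 * σ2 + 8 * B ^ 2) / N)) := by
          gcongr
      _ = _ := by ring
  · intro x f hf hle
    have h1 : ∫⁻ s, ENNReal.ofReal ((m s + g s - f s) ^ 2) ∂d ≤
        2 * ε + 2 * ENNReal.ofReal (v f) := by
      rw [hv, ofReal_integral_eq_lintegral_ofReal (hdI f hf) (.of_forall fun s => sq_nonneg _),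
        hε, ← lintegral_const_mul _ (by fun_prop),
        ← lintegral_const_mul _ ((hdm f hf).pow_const 2).ennreal_ofReal,
        ← lintegral_add_left (by fun_prop)]
      refine lintegral_mono fun s => ?_
      rw [← ENNReal.ofReal_ofNat 2, ← ENNReal.ofReal_mul (by norm_num),
        ← ENNReal.ofReal_mul (by norm_num), ← ENNReal.ofReal_add (by positivity) (by positivity)]
      refine ENNReal.ofReal_le_ofReal ?_
      nlinarith [sq_nonneg ((m s + g s - f₀ s) + (f s - f₀ s))]
    refine h1.trans (add_le_add_right (mul_le_mul_right ?_ _) _)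
    rcases (hv0 f).eq_or_lt with h0 | hpos
    · rw [← h0]; simp
    have h2 := regression_basic hN (ξ := fun j => (x j).2 - m (x j).1)
      (u := fun j => m (x j).1 + g (x j).1 - f₀ (x j).1) (h := fun j => f (x j).1 - f₀ (x j).1)
      (X := empMean U x) (Y := empMean (Y f) x) (Z := empMean (Z f) x) hpos rfl rfl rfl (by
        convert hle using 4 <;> ring)
    have hU0 : 0 ≤ empMean U x :=
      mul_nonneg (by positivity) (Finset.sum_nonneg fun j _ => sq_nonneg _)
    calc ENNReal.ofReal (v f) ≤ ENNReal.ofReal (16 * empMean U x + R f x) :=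
          ENNReal.ofReal_le_ofReal h2
      _ = 16 * ENNReal.ofReal (empMean U x) + ENNReal.ofReal (R f x) := by
          rw [ENNReal.ofReal_add (by positivity) (hR0 f x), ENNReal.ofReal_mul (by norm_num),
            ENNReal.ofReal_ofNat]
      _ ≤ _ := by
          gcongr
          exact Finset.single_le_sum (f := fun f => ENNReal.ofReal (R f x))
            (fun _ _ => zero_le) hf

end Regression

/-! ### Mirror ascent on the simplex -/

lemma segment_comb {A : Type*} (p q : A → ℝ) (c : ℝ) : (1 - c) • q + c • p = q + c • (p - q) := by
  rw [smul_sub, sub_smul, one_smul]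
  abel

section Mirror

variable {A : Type*} [Fintype A] (W : MirrorMap A)

/-- All norms on a finite-dimensional space are equivalent: `nrm` is continuous and has a positive
minimum on the compact unit sphere of the sup norm. -/
lemma MirrorMap.exists_sum_abs_le :
    ∃ c : ℝ, ∀ x : A → ℝ, ∑ a, |x a| ≤ c * W.nrm x := by
  have hcont : Continuous W.nrm := by
    rw [← continuousOn_univ]
    exact W.nrm.convexOn.continuousOn isOpen_univ
  -- The sphere is empty only when the whole space is zero.
  rcases (Metric.sphere (0 : A → ℝ) 1).eq_empty_or_nonempty with hE | hE
  · refine ⟨0, fun x => ?_⟩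
    have hx : x = 0 := by
      by_contra hx
      have hn : ‖x‖ ≠ 0 := norm_ne_zero_iff.2 hx
      have : ‖x‖⁻¹ • x ∈ Metric.sphere (0 : A → ℝ) 1 := by simp [norm_smul, hn]
      rw [hE] at this
      exact this
    simp [hx]
  obtain ⟨y, hy, hmin⟩ := (isCompact_sphere (0 : A → ℝ) 1).exists_isMinOn hE hcont.continuousOn
  have hy0 : 0 < W.nrm y := by
    refine (apply_nonneg W.nrm y).lt_of_ne fun h => ?_
    rw [W.nrm_eq_zero y h.symm] at hy
    simp at hy
  refine ⟨Fintype.card A / W.nrm y, fun x => ?_⟩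
  have h1 : ∑ a, |x a| ≤ Fintype.card A * ‖x‖ := by
    rw [← nsmul_eq_mul, ← Finset.card_univ]
    exact Finset.sum_le_card_nsmul _ _ _ fun a _ => norm_le_pi_norm x a
  have h2 : ‖x‖ * W.nrm y ≤ W.nrm x := by
    rcases eq_or_ne x 0 with rfl | hx
    · simp
    have hn : 0 < ‖x‖ := norm_pos_iff.2 hx
    have h3 : W.nrm y ≤ W.nrm (‖x‖⁻¹ • x) := hmin (by simp [norm_smul, hn.ne'])
    rw [map_smul_eq_mul, norm_inv, norm_norm] at h3
    calc ‖x‖ * W.nrm y ≤ ‖x‖ * (‖x‖⁻¹ * W.nrm x) := by gcongr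
      _ = W.nrm x := mul_inv_cancel_left₀ hn.ne' _
  calc ∑ a, |x a| ≤ Fintype.card A * ‖x‖ := h1
    _ = Fintype.card A / W.nrm y * (‖x‖ * W.nrm y) := by field_simp
    _ ≤ _ := by gcongr

lemma MirrorMap.fderiv_apply (p v : A → ℝ) :
    fderiv ℝ W.ω p v = ∑ a, W.grad p a * v a := by
  classical
  conv_lhs => rw [pi_eq_sum_univ' v]
  rw [map_sum]
  refine Finset.sum_congr rfl fun a _ => ?_
  rw [map_smul, smul_eq_mul, mul_comm, MirrorMap.grad]

/-- The Bregman divergence of the mirror map. -/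
def MirrorMap.bregman (p q : A → ℝ) : ℝ := W.ω p - W.ω q - ∑ a, W.grad q a * (p a - q a)

/-- Strong convexity on the segment from `q` to `p` bounds the difference quotient of `ω` at `q`;
the step is sent to `0` from the right. Differentiability is needed at `q` only. -/
lemma MirrorMap.half_sq_le_bregman {p q : A → ℝ} (hp : p ∈ stdSimplex ℝ A)
    (hq : q ∈ stdSimplex ℝ A) (hd : DifferentiableAt ℝ W.ω q) :
    W.nrm (p - q) ^ 2 / 2 ≤ W.bregman p q := by
  have h1 : HasDerivAt (fun c : ℝ => W.ω (q + c • (p - q))) (fderiv ℝ W.ω q (p - q)) 0 := by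
    have := hd.hasFDerivAt.hasLineDerivAt (p - q)
    exact this
  have h2 := h1.tendsto_slope_zero_right
  have h3 : Filter.Tendsto (fun c : ℝ => W.ω p - W.ω q - (1 - c) / 2 * W.nrm (p - q) ^ 2)
      (nhdsWithin 0 (Set.Ioi 0)) (nhds (W.ω p - W.ω q - (1 - 0) / 2 * W.nrm (p - q) ^ 2)) := by
    refine Filter.Tendsto.mono_left (Continuous.tendsto ?_ 0) nhdsWithin_le_nhds
    fun_prop
  have h4 := le_of_tendsto_of_tendsto h2 h3 (by
    filter_upwards [Ioo_mem_nhdsGT (zero_lt_one' ℝ)] with c hc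
    have h5 := W.strong_convex q hq p hp (1 - c) c (by linarith [hc.2]) hc.1.le (by ring)
    rw [segment_comb, map_sub_rev W.nrm q p] at h5
    simp only [zero_add, zero_smul, add_zero, smul_eq_mul]
    rw [inv_mul_le_iff₀ hc.1]
    nlinarith)
  rw [W.fderiv_apply] at h4
  simp only [Pi.sub_apply] at h4
  unfold MirrorMap.bregman
  linarith

lemma MirrorMap.bregman_nonneg {p q : A → ℝ} (hp : p ∈ stdSimplex ℝ A)
    (hq : q ∈ stdSimplex ℝ A) (hd : DifferentiableAt ℝ W.ω q) : 0 ≤ W.bregman p q :=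
  (by positivity : 0 ≤ W.nrm (p - q) ^ 2 / 2).trans (W.half_sq_le_bregman hp hq hd)

variable {W} {η : ℝ} {f q : A → ℝ}

lemma MirrorMap.differentiableAt_of_isMaxOn (hη : 0 < η) (hq : q ∈ stdSimplex ℝ A)
    (h : IsMaxOn (fun p : A → ℝ => ∑ a, f a * p a - 1 / η * W.ω p) (stdSimplex ℝ A) q) :
    DifferentiableAt ℝ W.ω q := by
  refine W.diff_argmax (fun a => η * f a) q hq fun p hp => ?_
  have h1 := mul_le_mul_of_nonneg_left (h hp) hη.le
  simp only [mul_sub, Finset.mul_sum, ← mul_assoc, mul_one_div_cancel hη.ne', one_mul] at h1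
  exact h1

/-- First-order optimality of a mirror step. -/
lemma MirrorMap.sum_le_zero_of_isMaxOn (hη : 0 < η) (hq : q ∈ stdSimplex ℝ A)
    (h : IsMaxOn (fun p : A → ℝ => ∑ a, f a * p a - 1 / η * W.ω p) (stdSimplex ℝ A) q)
    {p : A → ℝ} (hp : p ∈ stdSimplex ℝ A) :
    ∑ a, (f a - 1 / η * W.grad q a) * (p a - q a) ≤ 0 := by
  have hd := (MirrorMap.differentiableAt_of_isMaxOn hη hq h).hasFDerivAt
  have hlin : HasFDerivAt (fun p : A → ℝ => ∑ a, f a * p a)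
      (∑ a, f a • ContinuousLinearMap.proj (R := ℝ) (φ := fun _ : A => ℝ) a) q := by
    refine HasFDerivAt.fun_sum fun a _ => ?_
    exact (ContinuousLinearMap.proj (R := ℝ) (φ := fun _ : A => ℝ) a).hasFDerivAt.const_mul (f a)
  have h1 := h.localize.hasFDerivWithinAt_nonpos
    (hlin.sub (hd.const_mul (1 / η))).hasFDerivWithinAt
    (sub_mem_posTangentConeAt_of_segment_subset
      ((convex_stdSimplex ℝ A).segment_subset hq hp))
  simp only [sub_apply, sum_apply,
    smul_apply, ContinuousLinearMap.proj_apply, smul_eq_mul,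
    W.fderiv_apply, Pi.sub_apply] at h1
  simp only [sub_mul, Finset.sum_sub_distrib, mul_assoc, ← Finset.mul_sum]
  linarith

/-- First-order optimality at `q` and the quadratic lower bound on the Bregman divergence leave no
room for a second maximizer. Uniqueness makes the next policy a function of the fitted functions. -/
lemma MirrorMap.isMaxOn_unique (hη : 0 < η) {p : A → ℝ} (hp : p ∈ stdSimplex ℝ A)
    (hq : q ∈ stdSimplex ℝ A)
    (h : IsMaxOn (fun p : A → ℝ => ∑ a, f a * p a - 1 / η * W.ω p) (stdSimplex ℝ A) q)
    (h' : IsMaxOn (fun p : A → ℝ => ∑ a, f a * p a - 1 / η * W.ω p) (stdSimplex ℝ A) p) :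
    p = q := by
  have h0 := h' hq
  have h1 := MirrorMap.sum_le_zero_of_isMaxOn hη hq h hp
  have h2 := W.half_sq_le_bregman hp hq (MirrorMap.differentiableAt_of_isMaxOn hη hq h)
  have h3 : 1 / η * (W.nrm (p - q) ^ 2 / 2) ≤ 0 := by
    refine (mul_le_mul_of_nonneg_left h2 (by positivity)).trans ?_
    simp only [sub_mul, mul_sub, Finset.sum_sub_distrib, mul_assoc, ← Finset.mul_sum,
      MirrorMap.bregman, Set.mem_ofPred_eq] at h0 h1 ⊢
    linarith
  have h4 : W.nrm (p - q) = 0 := by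
    by_contra h5
    have : 0 < W.nrm (p - q) := (apply_nonneg _ _).lt_of_ne' h5
    have : 0 < 1 / η * (W.nrm (p - q) ^ 2 / 2) := by positivity
    linarith
  exact sub_eq_zero.1 (W.nrm_eq_zero _ h4)

lemma abs_sub_le_one_of_mem_stdSimplex {p q : A → ℝ} (hp : p ∈ stdSimplex ℝ A)
    (hq : q ∈ stdSimplex ℝ A) (a : A) : |p a - q a| ≤ 1 := by
  have h1 := mem_Icc_of_mem_stdSimplex hp a
  have h2 := mem_Icc_of_mem_stdSimplex hq a
  rw [abs_le]
  constructor <;> linarith [h1.1, h1.2, h2.1, h2.2]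

/-- One step of approximate mirror ascent. -/
lemma MirrorMap.mirror_step (hη : 0 < η) {c : ℝ} (hc : ∀ x : A → ℝ, ∑ a, |x a| ≤ c * W.nrm x)
    {p p₀ p₁ Q : A → ℝ} {K : ℝ} (hK : ∀ a, |Q a| ≤ K) (hK0 : 0 ≤ K) (hp : p ∈ stdSimplex ℝ A)
    (hp₀ : p₀ ∈ stdSimplex ℝ A) (hd : DifferentiableAt ℝ W.ω p₀) (hp₁ : p₁ ∈ stdSimplex ℝ A)
    (h : IsMaxOn (fun p : A → ℝ => ∑ a, f a * p a - 1 / η * W.ω p) (stdSimplex ℝ A) p₁) :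
    ∑ a, (p a - p₀ a) * Q a ≤ 1 / η * (W.bregman p p₀ - W.bregman p p₁) + η * (c * K) ^ 2 / 2 +
      ∑ a, |Q a + 1 / η * W.grad p₀ a - f a| := by
  have h1 := MirrorMap.sum_le_zero_of_isMaxOn hη hp₁ h hp
  have h2 := W.half_sq_le_bregman hp₁ hp₀ hd
  have h3 : ∑ a, (Q a + 1 / η * W.grad p₀ a - f a) * (p a - p₁ a) ≤
      ∑ a, |Q a + 1 / η * W.grad p₀ a - f a| := by
    refine Finset.sum_le_sum fun a _ => (le_abs_self _).trans ?_
    rw [abs_mul]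
    exact mul_le_of_le_one_right (abs_nonneg _) (abs_sub_le_one_of_mem_stdSimplex hp hp₁ a)
  have h4 : ∑ a, Q a * (p₁ a - p₀ a) ≤ η * (c * K) ^ 2 / 2 + 1 / η * (W.nrm (p₁ - p₀) ^ 2 / 2) := by
    have h5 : ∑ a, Q a * (p₁ a - p₀ a) ≤ K * (c * W.nrm (p₁ - p₀)) := by
      calc ∑ a, Q a * (p₁ a - p₀ a) ≤ ∑ a, K * |(p₁ - p₀) a| := by
            refine Finset.sum_le_sum fun a _ => (le_abs_self _).trans ?_
            rw [abs_mul]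
            exact mul_le_mul_of_nonneg_right (hK a) (abs_nonneg _)
        _ = K * ∑ a, |(p₁ - p₀) a| := by rw [Finset.mul_sum]
        _ ≤ _ := mul_le_mul_of_nonneg_left (hc _) hK0
    refine h5.trans ?_
    -- Young's inequality by completing the square. The quadratic term is later absorbed by
    -- `-W.bregman p₁ p₀ / η`.
    have h6 : η * (c * K) ^ 2 / 2 + 1 / η * (W.nrm (p₁ - p₀) ^ 2 / 2) -
        K * (c * W.nrm (p₁ - p₀)) = (η * (c * K) - W.nrm (p₁ - p₀)) ^ 2 / (2 * η) := by
      field_simp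
      ring
    have h7 : 0 ≤ (η * (c * K) - W.nrm (p₁ - p₀)) ^ 2 / (2 * η) := by positivity
    linarith
  have h8 : 1 / η * (W.nrm (p₁ - p₀) ^ 2 / 2) ≤ 1 / η * W.bregman p₁ p₀ :=
    mul_le_mul_of_nonneg_left h2 (by positivity)
  -- The four terms are the progress of the step, the regression error, the optimality defect
  -- (nonpositive by `h1`) and the three-point identity for Bregman divergences.
  have h9 : ∑ a, (p a - p₀ a) * Q a = ∑ a, Q a * (p₁ a - p₀ a) +
      ∑ a, (Q a + 1 / η * W.grad p₀ a - f a) * (p a - p₁ a) +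
      ∑ a, (f a - 1 / η * W.grad p₁ a) * (p a - p₁ a) +
      1 / η * (W.bregman p p₀ - W.bregman p p₁ - W.bregman p₁ p₀) := by
    have h10 : W.bregman p p₀ - W.bregman p p₁ - W.bregman p₁ p₀ =
        ∑ a, (W.grad p₁ a - W.grad p₀ a) * (p a - p₁ a) := by
      simp only [MirrorMap.bregman]
      have : ∑ a, W.grad p₀ a * (p a - p₀ a) = ∑ a, W.grad p₀ a * (p a - p₁ a) +
          ∑ a, W.grad p₀ a * (p₁ a - p₀ a) := by
        rw [← Finset.sum_add_distrib]
        exact Finset.sum_congr rfl fun a _ => by ring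
      rw [this]
      simp only [sub_mul, Finset.sum_sub_distrib]
      ring
    rw [h10, Finset.mul_sum, ← Finset.sum_add_distrib, ← Finset.sum_add_distrib,
      ← Finset.sum_add_distrib]
    exact Finset.sum_congr rfl fun a _ => by ring
  rw [h9]
  linarith

/-- The Bregman divergence from the uniform vector is bounded on the simplex. -/
lemma MirrorMap.exists_bregman_unif_le [Nonempty A] (W : MirrorMap A) :
    ∃ D : ℝ, 0 ≤ D ∧ ∀ p ∈ stdSimplex ℝ A,
      W.bregman p (fun _ => (Fintype.card A : ℝ)⁻¹) ≤ D := by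
  classical
  set u : A → ℝ := fun _ => (Fintype.card A : ℝ)⁻¹ with hu
  have hus : u ∈ stdSimplex ℝ A := by
    refine ⟨fun a => by positivity, ?_⟩
    simp [hu]
  have hconv : ConvexOn ℝ (stdSimplex ℝ A) W.ω := by
    refine ⟨convex_stdSimplex ℝ A, fun p hp q hq b c hb hc hbc => ?_⟩
    have h1 := W.strong_convex p hp q hq b c hb hc hbc
    have h2 : 0 ≤ b * c / 2 * W.nrm (p - q) ^ 2 := by positivity
    simp only [smul_eq_mul]
    linarith
  refine ⟨∑ a, |W.ω (Pi.single a 1)| + |W.ω u| + ∑ a, |W.grad u a|, by positivity, fun p hp => ?_⟩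
  -- Jensen's inequality at the vertices bounds `ω` on the simplex without any continuity at the
  -- boundary.
  have h1 : W.ω p ≤ ∑ a, |W.ω (Pi.single a 1)| := by
    have h2 := hconv.map_sum_le (t := Finset.univ) (w := p) (p := fun a => Pi.single a (1 : ℝ))
      (fun a _ => hp.1 a) hp.2 fun a _ => single_mem_stdSimplex ℝ a
    have h3 : ∑ a, p a • (Pi.single a (1 : ℝ) : A → ℝ) = p := by
      rw [← Finset.univ_sum_single p]
      refine Finset.sum_congr rfl fun a _ => ?_
      ext b
      simp [Pi.single_apply]
    rw [h3] at h2
    refine h2.trans (Finset.sum_le_sum fun a _ => (le_abs_self _).trans ?_)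
    rw [smul_eq_mul, abs_mul, abs_of_nonneg (hp.1 a)]
    exact mul_le_of_le_one_left (abs_nonneg _) (mem_Icc_of_mem_stdSimplex hp a).2
  have h4 : -∑ a, W.grad u a * (p a - u a) ≤ ∑ a, |W.grad u a| := by
    rw [← Finset.sum_neg_distrib]
    refine Finset.sum_le_sum fun a _ => (neg_le_abs _).trans ?_
    rw [abs_mul]
    exact mul_le_of_le_one_right (abs_nonneg _) (abs_sub_le_one_of_mem_stdSimplex hp hus a)
  have h5 := neg_le_abs (W.ω u)
  unfold MirrorMap.bregman
  linarith

/-- The regret bound of approximate mirror ascent started at the uniform vector. -/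
lemma MirrorMap.mirror_regret (hη : 0 < η) {c : ℝ}
    (hc : ∀ x : A → ℝ, ∑ a, |x a| ≤ c * W.nrm x) {T : ℕ} {p : A → ℝ} {x Q f : ℕ → A → ℝ} {K : ℝ}
    (hK : ∀ t a, |Q t a| ≤ K) (hK0 : 0 ≤ K) (hp : p ∈ stdSimplex ℝ A)
    (hx : ∀ t, x t ∈ stdSimplex ℝ A) (hx0 : x 0 = fun _ => (Fintype.card A : ℝ)⁻¹)
    (h : ∀ t < T, IsMaxOn (fun p : A → ℝ => ∑ a, f t a * p a - 1 / η * W.ω p)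
      (stdSimplex ℝ A) (x (t + 1))) :
    ∑ t ∈ Finset.range T, ∑ a, (p a - x t a) * Q t a ≤
      1 / η * W.bregman p (fun _ => (Fintype.card A : ℝ)⁻¹) + T * (η * (c * K) ^ 2 / 2) +
      ∑ t ∈ Finset.range T, ∑ a, |Q t a + 1 / η * W.grad (x t) a - f t a| := by
  have hd (t : ℕ) (ht : t ≤ T) : DifferentiableAt ℝ W.ω (x t) := by
    cases t with
    | zero => rw [hx0]; exact W.diff_unif
    | succ t => exact MirrorMap.differentiableAt_of_isMaxOn hη (hx _) (h t (by omega))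
  have h1 : ∑ t ∈ Finset.range T, ∑ a, (p a - x t a) * Q t a ≤
      ∑ t ∈ Finset.range T, (1 / η * (W.bregman p (x t) - W.bregman p (x (t + 1))) +
        η * (c * K) ^ 2 / 2 + ∑ a, |Q t a + 1 / η * W.grad (x t) a - f t a|) :=
    Finset.sum_le_sum fun t ht => by
      have ht := Finset.mem_range.1 ht
      exact MirrorMap.mirror_step hη hc (hK t) hK0 hp (hx t) (hd t ht.le) (hx _) (h t ht)
  -- The Bregman terms telescope; the last one is nonnegative and is dropped.
  rw [Finset.sum_add_distrib, Finset.sum_add_distrib, ← Finset.mul_sum,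
    Finset.sum_range_sub', Finset.sum_const, Finset.card_range, nsmul_eq_mul, hx0] at h1
  have h2 : 0 ≤ 1 / η * W.bregman p (x T) :=
    mul_nonneg (by positivity) (W.bregman_nonneg hp (hx T) (hd T le_rfl))
  linarith

end Mirror

lemma eLpNorm_two_sq {X : Type*} [MeasurableSpace X] (μ : Measure X) (f : X → ℝ) :
    eLpNorm f 2 μ ^ 2 = ∫⁻ x, ENNReal.ofReal (f x ^ 2) ∂μ := by
  rw [eLpNorm_eq_lintegral_rpow_enorm_toReal two_ne_zero ENNReal.ofNat_ne_top,
    ENNReal.toReal_ofNat, ← ENNReal.rpow_natCast, ← ENNReal.rpow_mul]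
  norm_num
  refine lintegral_congr fun x => ?_
  rw [← sq_abs, ENNReal.ofReal_pow (abs_nonneg _), ← Real.norm_eq_abs, ofReal_norm]

/-! ### Conditioning on the current policy -/

section RunMeasurability

variable {S A : Type*} [MeasurableSpace S] [Fintype A] [MeasurableSpace A]
  [MeasurableSingletonClass A]

lemma Policy.ext_prob {π π' : Policy S A} (h : ∀ s, π.prob s = π'.prob s) : π = π' := by
  cases π; cases π'
  congr
  exact funext h

variable {M : MDP S A} {W : MirrorMap A} {C : Set (Transition S A)} {η : ℝ} {T N : ℕ}
  {F : ℕ → A → Set (S → ℝ)} {Ω : Type*} [mΩ : MeasurableSpace Ω] {ν : Measure Ω}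

/-- The gradient at `π_t` is part of the regression target, so the mirror step sees the past only
through the fitted functions, and its maximizer is unique. -/
lemma Run.policy_succ_eq (R : Run M W C η T N F ν) (hη : 0 < η) {t : ℕ} (ht : t < T) {o o' : Ω}
    (h : ∀ a, R.fhat t a o = R.fhat t a o') : R.policy (t + 1) o = R.policy (t + 1) o' := by
  refine Policy.ext_prob fun s => ?_
  have h1 := R.policy_succ t ht o s
  simp only [h] at h1
  exact MirrorMap.isMaxOn_unique hη ((R.policy (t + 1) o).mem_simplex s)
    ((R.policy (t + 1) o').mem_simplex s) (R.policy_succ t ht o' s) h1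

lemma Run.policy_zero_eq (R : Run M W C η T N F ν) (o o' : Ω) :
    R.policy 0 o = R.policy 0 o' :=
  Policy.ext_prob fun s => funext fun a => by rw [R.policy_zero, R.policy_zero]

lemma Run.finite_range_fhat (R : Run M W C η T N F ν) {t : ℕ} (ht : t < T)
    (hF : ∀ a, (F t a).Finite) : (Set.range fun o a => R.fhat t a o).Finite := by
  refine (Set.Finite.pi hF).subset ?_
  rintro _ ⟨o, rfl⟩ a _
  exact R.fhat_mem t ht a o

/-- The policies that can occur in an iteration form a finite set. -/
lemma Run.finite_range_policy (R : Run M W C η T N F ν) (hη : 0 < η)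
    (hF : ∀ t < T, ∀ a, (F t a).Finite) {t : ℕ} (ht : t ≤ T) :
    (Set.range (R.policy t)).Finite := by
  cases t with
  | zero =>
    refine Set.Subsingleton.finite ?_
    rintro _ ⟨o, rfl⟩ _ ⟨o', rfl⟩
    exact R.policy_zero_eq o o'
  | succ t =>
    have hf := R.finite_range_fhat (t := t) (by omega) (hF t (by omega))
    have hfac : (R.policy (t + 1)).FactorsThrough fun o a => R.fhat t a o := fun o o' h =>
      R.policy_succ_eq hη (by omega) fun a => congrFun h a
    rcases isEmpty_or_nonempty Ω with hΩ | ⟨⟨o₀⟩⟩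
    · rw [Set.range_eq_empty]; exact Set.finite_empty
    rw [← hfac.extend_comp (fun _ => R.policy 0 o₀), Set.range_comp]
    exact hf.image _

/-- The current policy is determined by the past. -/
lemma Run.measurableSet_policy (R : Run M W C η T N F ν) (hη : 0 < η)
    (hF : ∀ t < T, ∀ a, (F t a).Finite) {t : ℕ} (ht : t ≤ T) (π : Policy S A) :
    MeasurableSet[R.𝒢 t] {o | R.policy t o = π} := by
  cases t with
  | zero =>
    by_cases h : ∃ o, R.policy 0 o = π
    · obtain ⟨o, rfl⟩ := h
      convert @MeasurableSet.univ Ω (R.𝒢 0)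
      exact Set.eq_univ_of_forall fun o' => R.policy_zero_eq o' o
    · convert @MeasurableSet.empty Ω (R.𝒢 0)
      exact Set.eq_empty_of_forall_notMem fun o ho => h ⟨o, ho⟩
  | succ t =>
    set Φ : Ω → A → S → ℝ := fun o a => R.fhat t a o with hΦ
    have hf : (Φ '' {o | R.policy (t + 1) o = π}).Finite :=
      (R.finite_range_fhat (t := t) (by omega) (hF t (by omega))).subset
        (Set.image_subset_range _ _)
    -- The event is a finite union over the tuples of fitted functions that lead to `π`.
    have heq : {o | R.policy (t + 1) o = π} =
        ⋃ f ∈ Φ '' {o | R.policy (t + 1) o = π}, ⋂ a, {o | R.fhat t a o = f a} := by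
      ext o
      simp only [Set.mem_iUnion, Set.mem_iInter, exists_prop]
      constructor
      · exact fun ho => ⟨Φ o, ⟨o, ho, rfl⟩, fun a => rfl⟩
      · rintro ⟨_, ⟨o', ho', rfl⟩, h⟩
        exact (R.policy_succ_eq hη (by omega) h).trans ho'
    rw [heq]
    exact hf.measurableSet_biUnion fun f _ =>
      MeasurableSet.iInter fun a => R.measurable_fhat t (by omega) a (f a)

/-- The sample of iteration `t` for action `a`. -/
def Run.sample (R : Run M W C η T N F ν) (t : ℕ) (a : A) (o : Ω) : Fin N → S × ℝ :=
  fun j => (R.state t j o, R.rollout t a j o)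

lemma Run.measurable_sample (R : Run M W C η T N F ν) {t : ℕ} (ht : t < T) (a : A) :
    Measurable (R.sample t a) :=
  measurable_pi_lambda _ fun j =>
    ((R.measurable_state t ht j).mono (R.𝒢.le _) le_rfl).prodMk
      ((R.measurable_rollout t ht a j).mono (R.𝒢.le _) le_rfl)

/-- Given the current policy, the sample is i.i.d. -/
lemma Run.map_sample_restrict (R : Run M W C η T N F ν) (hη : 0 < η)
    (hF : ∀ t < T, ∀ a, (F t a).Finite) {t : ℕ} (ht : t < T) (a : A) (π : Policy S A) :
    (ν.restrict {o | R.policy t o = π}).map (R.sample t a) =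
      ν {o | R.policy t o = π} • Measure.pi fun _ => sampleLaw M (R.oracle t π) π a := by
  have hG := R.measurableSet_policy hη hF ht.le π
  have hG' := R.𝒢.le t _ hG
  ext E hE
  rw [Measure.map_apply (R.measurable_sample ht a) hE,
    Measure.restrict_apply (R.measurable_sample ht a hE), Set.inter_comm]
  -- On the event that the policy is `π` the oracle's model is fixed as well, so the conditional law
  -- is constant there.
  refine (R.sample_law t ht a _ hG E hE).trans ?_
  rw [setLIntegral_congr_fun hG' (g := fun _ => Measure.pi
    (fun _ : Fin N => sampleLaw M (R.oracle t π) π a) E) fun o ho => by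
      simp only [Set.mem_ofPred_eq] at ho
      simp only [ho]]
  rw [setLIntegral_const, Measure.smul_apply, smul_eq_mul, mul_comm]

/-- A bound for the conditional expectation of a function of the policy and the sample gives a
bound for the expectation. -/
lemma Run.lintegral_sample_le (R : Run M W C η T N F ν) [IsProbabilityMeasure ν] (hη : 0 < η)
    (hF : ∀ t < T, ∀ a, (F t a).Finite) {t : ℕ} (ht : t < T) (a : A)
    {H : Policy S A → (Fin N → S × ℝ) → ℝ≥0∞} (hH : ∀ π, Measurable (H π)) {c : ℝ≥0∞}
    (hc : ∀ π, ∫⁻ x, H π x ∂(Measure.pi fun _ => sampleLaw M (R.oracle t π) π a) ≤ c) :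
    Measurable (fun o => H (R.policy t o) (R.sample t a o)) ∧
      ∫⁻ o, H (R.policy t o) (R.sample t a o) ∂ν ≤ c := by
  classical
  set s := (R.finite_range_policy hη hF ht.le).toFinset with hs
  have hG (π) : MeasurableSet {o | R.policy t o = π} :=
    R.𝒢.le t _ (R.measurableSet_policy hη hF ht.le π)
  have hX := R.measurable_sample ht a
  -- Splitting over the finitely many policies avoids any measurable structure on the set of
  -- policies.
  have heq : (fun o => H (R.policy t o) (R.sample t a o)) = fun o => ∑ π ∈ s,
      {o | R.policy t o = π}.indicator (fun o => H π (R.sample t a o)) o := by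
    funext o
    rw [Finset.sum_eq_single (R.policy t o)]
    · simp
    · intro π _ hπ
      exact Set.indicator_of_notMem (fun h => hπ h.symm) _
    · intro h
      simp [hs] at h
  have hm (π) : Measurable ({o | R.policy t o = π}.indicator fun o => H π (R.sample t a o)) :=
    ((hH π).comp hX).indicator (hG π)
  rw [heq]
  refine ⟨Finset.measurable_fun_sum _ fun π _ => hm π, ?_⟩
  rw [lintegral_finsetSum _ fun π _ => hm π]
  have h1 (π) : ∫⁻ o, {o | R.policy t o = π}.indicator (fun o => H π (R.sample t a o)) o ∂ν ≤
      ν {o | R.policy t o = π} * c := by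
    rw [lintegral_indicator (hG π), ← lintegral_map (hH π) hX, R.map_sample_restrict hη hF ht,
      lintegral_smul_measure, smul_eq_mul]
    exact mul_le_mul_right (hc π) _
  refine (Finset.sum_le_sum fun π _ => h1 π).trans ?_
  rw [← Finset.sum_mul]
  have h2 : ∑ π ∈ s, ν {o | R.policy t o = π} ≤ 1 := by
    rw [← measure_biUnion_finset (fun π _ π' _ h => Set.disjoint_left.2 fun o ho ho' =>
      h (ho.symm.trans ho')) fun π _ => hG π]
    exact prob_le_one
  exact mul_le_of_le_one_left (zero_le) h2

end RunMeasurability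

lemma rpow_half_sq (x : ℝ≥0∞) : (x ^ (1 / 2 : ℝ)) ^ 2 = x := by
  rw [← ENNReal.rpow_natCast, ← ENNReal.rpow_mul]
  norm_num

/-! ### Regression errors of a run -/

section RunRegression

variable {S A : Type*} [MeasurableSpace S] [Fintype A] [MeasurableSpace A]
  [MeasurableSingletonClass A]

/-- The derivative of an arbitrary real function on `A → ℝ` is measurable, so no smoothness of `ω`
is involved. -/
lemma measurable_grad (W : MirrorMap A) (π : Policy S A) (a : A) :
    Measurable fun s => W.grad (π.prob s) a := by
  unfold MirrorMap.grad
  exact (measurable_fderiv_apply_const ℝ W.ω _).comp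
    (measurable_pi_lambda _ π.measurable_prob)

lemma measurable_Qfun_left (M : MDP S A) (P : Transition S A) (π : Policy S A) (a : A) :
    Measurable fun s => Qfun M P π s a :=
  measurable_integral_kernel ((trajKernel P π).comap (fun s => (s, a)) measurable_prodMk_right)
    (measurable_discountedReturn M)

lemma measurable_augQ (M : MDP S A) (W : MirrorMap A) (η : ℝ) (P : Transition S A)
    (π : Policy S A) (a : A) : Measurable (augQ M W η P π a) := by
  have h1 := measurable_Qfun_left M P π a
  have h2 : Measurable fun s => 1 / η * W.grad (π.prob s) a := (measurable_grad W π a).const_mul _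
  unfold augQ
  exact h1.add h2

/-- Normalized regression bound for a given policy and model. -/
lemma exists_normalized_regression_bound (M : MDP S A) (W : MirrorMap A) (η : ℝ)
    (P : Transition S A) (π : Policy S A) (a : A) {B : ℝ} (hB : 1 / (1 - M.γ) ≤ B)
    {F : Set (S → ℝ)} (hfin : F.Finite) (hne : F.Nonempty)
    (hF : ∀ f ∈ F, Measurable f ∧ ∀ s, |f s| ≤ B) {N : ℕ} (hN : 0 < N) {m : ℝ≥0∞}
    (hm : ((F.encard : ℕ∞) : ℝ≥0∞) ≤ m) :
    ∃ H : (Fin N → S × ℝ) → ℝ≥0∞, Measurable H ∧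
      ∫⁻ x, H x ∂(Measure.pi fun _ => sampleLaw M P π a) ≤ 272 ∧
      ∀ (x : Fin N → S × ℝ) (f : S → ℝ) (D : ℝ≥0∞), f ∈ F → D ≠ ∞ →
        (∀ f' ∈ F, empLoss W η π a (fun j => (x j).1) (fun j => (x j).2) f ≤
          empLoss W η π a (fun j => (x j).1) (fun j => (x j).2) f') →
        (⨅ f ∈ F, eLpNorm (fun s => augQ M W η P π a s - f s) 2 (stateOccupancy M P π)) ^ 2 +
          m * ENNReal.ofReal (B ^ 2 / N) ≤ D →
        eLpNorm (fun s => augQ M W η P π a s - f s) 2 (stateOccupancy M P π) ^ 2 ≤ H x * D := by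
  have h0 := M.one_sub_pos
  have hNR : (0 : ℝ) < N := by exact_mod_cast hN
  have hB0 : 0 < B := lt_of_lt_of_le (by positivity) hB
  set d := stateOccupancy M P π with hd
  -- The class is finite, so a best approximation exists and serves as the reference function.
  obtain ⟨f₀, hf₀, hmin⟩ := Set.exists_min_image F
    (fun f => eLpNorm (fun s => augQ M W η P π a s - f s) 2 d) hfin hne
  have hQm := measurable_Qfun_left M P π a
  have hvar (s : S) : ∫ q, (q - Qfun M P π s a) ^ 2 ∂(rolloutKernel M P π a s) ≤ 2 * B ^ 2 := by
    refine (integral_rollout_sub_sq_le M P π a s).trans ?_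
    have h1 : (1 / (1 - M.γ)) ^ 2 ≤ B ^ 2 := pow_le_pow_left₀ (by positivity) hB 2
    calc 2 / (1 - M.γ) ^ 2 = 2 * (1 / (1 - M.γ)) ^ 2 := by field_simp
      _ ≤ _ := by linarith
  obtain ⟨Ψ, hΨm, hΨi, hΨ⟩ := exists_regression_bound d (rolloutKernel M P π a) hQm
    (by positivity) (memLp_rollout M P π a) (integral_rollout M P π a) hvar
    ((measurable_grad W π a).const_mul (1 / η)) hfin.toFinset
    (fun f hf => hF f (hfin.mem_toFinset.1 hf)) (hfin.mem_toFinset.2 hf₀) hN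
  set E := eLpNorm (fun s => augQ M W η P π a s - f₀ s) 2 d with hE
  have hEinf : E = ⨅ f ∈ F, eLpNorm (fun s => augQ M W η P π a s - f s) 2 d :=
    le_antisymm (le_iInf₂ hmin) (iInf₂_le f₀ hf₀)
  rw [← hEinf]
  -- `D₀` depends on the given policy and model alone, so dividing by it is legitimate inside the
  -- conditional expectation. The random approximation error enters afterwards as `D`, which
  -- dominates `D₀`.
  set D₀ := E ^ 2 + m * ENNReal.ofReal (B ^ 2 / N) with hD₀
  have hcard : (hfin.toFinset.card : ℝ≥0∞) ≤ m := by
    rw [hfin.encard_eq_coe_toFinset_card] at hm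
    exact_mod_cast hm
  have hm0 : m ≠ 0 := by
    rintro rfl
    have h1 : 0 < hfin.toFinset.card := Finset.card_pos.2 ⟨f₀, hfin.mem_toFinset.2 hf₀⟩
    rw [nonpos_iff_eq_zero] at hcard
    exact h1.ne' (by exact_mod_cast hcard)
  have hb0 : ENNReal.ofReal (B ^ 2 / N) ≠ 0 := by
    rw [Ne, ENNReal.ofReal_eq_zero, not_le]
    positivity
  have hD0 : D₀ ≠ 0 := by
    rw [hD₀, Ne, add_eq_zero, mul_eq_zero]
    tauto
  -- With `σ2 = 2 * B ^ 2` the fluctuation constant is `128 * 2 + 16 = 272`, which also exceeds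
  -- `34`.
  have hint : ∫⁻ x, Ψ x ∂(Measure.pi fun _ => sampleLaw M P π a) ≤ 272 * D₀ := by
    refine hΨi.trans ?_
    have h1 : ENNReal.ofReal ((128 * (2 * B ^ 2) + 16 * B ^ 2) / N) =
        272 * ENNReal.ofReal (B ^ 2 / N) := by
      rw [← ENNReal.ofReal_ofNat 272, ← ENNReal.ofReal_mul (by norm_num)]
      congr 1
      ring
    have h2 : ∫⁻ s, ENNReal.ofReal ((Qfun M P π s a + 1 / η * W.grad (π.prob s) a - f₀ s) ^ 2) ∂d =
        E ^ 2 := (eLpNorm_two_sq d _).symm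
    rw [h1, h2, hD₀, mul_add]
    refine add_le_add (mul_le_mul_left (by norm_num) _) ?_
    rw [mul_left_comm 272]
    exact mul_le_mul_left hcard _
  refine ⟨fun x => Ψ x / D₀, hΨm.div_const _, ?_, fun x f D hf hD herm hle => ?_⟩
  · simp only [div_eq_mul_inv]
    rw [lintegral_mul_const _ hΨm, ← div_eq_mul_inv]
    exact ENNReal.div_le_of_le_mul hint
  · have h1 : eLpNorm (fun s => augQ M W η P π a s - f s) 2 d ^ 2 ≤ Ψ x := by
      rw [eLpNorm_two_sq]
      exact hΨ x f (hfin.mem_toFinset.2 hf) (herm f₀ hf₀)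
    refine h1.trans ?_
    calc Ψ x = Ψ x / D₀ * D₀ := (ENNReal.div_mul_cancel hD0 (ne_top_of_le_ne_top hD hle)).symm
      _ ≤ _ := by gcongr

variable {M : MDP S A} {W : MirrorMap A} {C : Set (Transition S A)} {η : ℝ} {T N : ℕ}
  {F : ℕ → A → Set (S → ℝ)} {Ω : Type*} [mΩ : MeasurableSpace Ω] {ν : Measure Ω}

/-- The regression error of iteration `t` and action `a`, in `L²` of the sampling distribution. -/
def Run.regError (R : Run M W C η T N F ν) (t : ℕ) (a : A) (o : Ω) : ℝ≥0∞ :=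
  eLpNorm (fun s => augQ M W η (R.model t o) (R.policy t o) a s - R.fhat t a o s) 2
    (stateOccupancy M (R.model t o) (R.policy t o))

lemma Run.iInf_le_epsApprox (R : Run M W C η T N F ν) {model : Set (Transition S A)}
    (hC : C ⊆ model) {t : ℕ} (ht : t < T) (a : A) (o : Ω) :
    ⨅ f ∈ F t a, eLpNorm (fun s => augQ M W η (R.model t o) (R.policy t o) a s - f s) 2
      (stateOccupancy M (R.model t o) (R.policy t o)) ≤ R.epsApprox model o := by
  unfold Run.epsApprox
  refine le_iSup₂_of_le (R.model t o) (hC (R.oracle_mem t ht o)) ?_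
  refine le_iSup_of_le (R.policy t o) ?_
  refine le_iSup₂_of_le t (Finset.mem_range.2 ht) ?_
  exact le_iSup_of_le a le_rfl

lemma encard_le_maxCard {t : ℕ} (ht : t < T) (a : A) :
    (((F t a).encard : ℕ∞) : ℝ≥0∞) ≤ maxCard F T :=
  le_iSup₂_of_le t (Finset.mem_range.2 ht) (le_iSup_of_le a le_rfl)

/-- The sum of the normalized squared regression errors has bounded expectation. -/
lemma Run.exists_sum_regError_sq_le (R : Run M W C η T N F ν) [IsProbabilityMeasure ν]
    (hη : 0 < η) (hfin : ∀ t < T, ∀ a, (F t a).Finite) {model : Set (Transition S A)}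
    (hC : C ⊆ model) (hN : 0 < N) {B : ℝ} (hB : 1 / (1 - M.γ) ≤ B)
    (hF : ∀ t < T, ∀ a, ∀ f ∈ F t a, Measurable f ∧ ∀ s, |f s| ≤ B) :
    ∃ Z : Ω → ℝ≥0∞, Measurable Z ∧ ∫⁻ o, Z o ∂ν ≤ T * (Fintype.card A * 272) ∧
      ∀ o, R.epsApprox model o ^ 2 + maxCard F T * ENNReal.ofReal (B ^ 2 / N) ≠ ∞ →
        ∑ t ∈ Finset.range T, ∑ a, R.regError t a o ^ 2 ≤
          Z o * (R.epsApprox model o ^ 2 + maxCard F T * ENNReal.ofReal (B ^ 2 / N)) := by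
  classical
  -- One outcome is needed to see that the function classes are nonempty.
  obtain ⟨o₀⟩ := nonempty_of_isProbabilityMeasure ν
  have key (t : ℕ) (a : A) (π : Policy S A) : ∃ H : (Fin N → S × ℝ) → ℝ≥0∞, t < T → 
      (Measurable H ∧ ∫⁻ x, H x ∂(Measure.pi fun _ => sampleLaw M (R.oracle t π) π a) ≤ 272 ∧
      ∀ (x : Fin N → S × ℝ) (f : S → ℝ) (D : ℝ≥0∞), f ∈ F t a → D ≠ ∞ →
        (∀ f' ∈ F t a, empLoss W η π a (fun j => (x j).1) (fun j => (x j).2) f ≤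
          empLoss W η π a (fun j => (x j).1) (fun j => (x j).2) f') →
        (⨅ f ∈ F t a, eLpNorm (fun s => augQ M W η (R.oracle t π) π a s - f s) 2
          (stateOccupancy M (R.oracle t π) π)) ^ 2 +
          maxCard F T * ENNReal.ofReal (B ^ 2 / N) ≤ D →
        eLpNorm (fun s => augQ M W η (R.oracle t π) π a s - f s) 2
          (stateOccupancy M (R.oracle t π) π) ^ 2 ≤ H x * D) := by
    by_cases ht : t < T
    · obtain ⟨H, hH⟩ := exists_normalized_regression_bound M W η (R.oracle t π) π a hB
        (hfin t ht a) ⟨_, R.fhat_mem t ht a o₀⟩ (hF t ht a) hN (encard_le_maxCard ht a)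
      exact ⟨H, fun _ => hH⟩
    · exact ⟨0, fun h => absurd h ht⟩
  choose H hH using key
  have hmeas (t : ℕ) (ht : t < T) (a : A) := R.lintegral_sample_le hη hfin ht a
    (H := H t a) (c := 272) (fun π => (hH t a π ht).1) (fun π => (hH t a π ht).2.1)
  refine ⟨fun o => ∑ t ∈ Finset.range T, ∑ a, H t a (R.policy t o) (R.sample t a o), ?_, ?_, ?_⟩
  · exact Finset.measurable_fun_sum _ fun t ht => Finset.measurable_fun_sum _ fun a _ =>
      (hmeas t (Finset.mem_range.1 ht) a).1
  · rw [lintegral_finsetSum _ fun t ht => Finset.measurable_fun_sum _ fun a _ =>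
      (hmeas t (Finset.mem_range.1 ht) a).1]
    refine (Finset.sum_le_card_nsmul (Finset.range T) _ ((Fintype.card A : ℝ≥0∞) * 272)
      fun t ht => ?_).trans_eq (by rw [Finset.card_range, nsmul_eq_mul])
    have ht := Finset.mem_range.1 ht
    rw [lintegral_finsetSum _ fun a _ => (hmeas t ht a).1]
    exact (Finset.sum_le_card_nsmul _ _ 272 fun a _ => (hmeas t ht a).2).trans_eq
      (by rw [Finset.card_univ, nsmul_eq_mul])
  · intro o hD
    rw [Finset.sum_mul]
    refine Finset.sum_le_sum fun t ht => ?_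
    have ht := Finset.mem_range.1 ht
    rw [Finset.sum_mul]
    refine Finset.sum_le_sum fun a _ => ?_
    refine (hH t a (R.policy t o) ht).2.2 (R.sample t a o) (R.fhat t a o) _
      (R.fhat_mem t ht a o) hD (R.fhat_min t ht a o) ?_
    gcongr
    exact R.iInf_le_epsApprox hC ht a o

/-- With high probability the average regression error is small. -/
lemma Run.measure_sum_regError_le (R : Run M W C η T N F ν) [IsProbabilityMeasure ν]
    (hη : 0 < η) (hfin : ∀ t < T, ∀ a, (F t a).Finite) {model : Set (Transition S A)}
    (hC : C ⊆ model) (hN : 0 < N) {B : ℝ} (hB : 1 / (1 - M.γ) ≤ B)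
    (hF : ∀ t < T, ∀ a, ∀ f ∈ F t a, Measurable f ∧ ∀ s, |f s| ≤ B)
    {δ : ℝ≥0∞} (hδ : δ ≠ 0) (hδ' : δ ≠ ∞) (hT : 0 < T) [Nonempty A] :
    ν {o | ¬ ∑ t ∈ Finset.range T, ∑ a, R.regError t a o ≤
      T * (Fintype.card A * ((272 / δ) ^ (1 / 2 : ℝ) * (R.epsApprox model o +
        ENNReal.ofReal B * (maxCard F T ^ (1 / 2 : ℝ) / (N : ℝ≥0∞) ^ (1 / 2 : ℝ)))))} ≤ δ := by
  obtain ⟨Z, hZm, hZi, hZ⟩ := R.exists_sum_regError_sq_le hη hfin hC hN hB hF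
  set k : ℝ≥0∞ := T * Fintype.card A with hk
  have hk0 : k ≠ 0 := by simp [hk, hT.ne']
  have hkt : k ≠ ∞ := by finiteness
  -- Markov's threshold: the bound `k * 272` on the expectation of `Z`, divided by `δ`.
  set θ : ℝ≥0∞ := k * (272 / δ) with hθ
  have hθ0 : θ ≠ 0 := mul_ne_zero hk0 (ENNReal.div_pos (by norm_num) hδ').ne'
  have hθt : θ ≠ ∞ := ENNReal.mul_ne_top hkt (ENNReal.div_ne_top (by norm_num) hδ)
  have hNR : (0 : ℝ) < N := by exact_mod_cast hN
  have hB0 : 0 < B := lt_of_lt_of_le (one_div_pos.2 M.one_sub_pos) hB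
  have hmarkov : ν {o | θ ≤ Z o} ≤ δ := by
    have h1 := (mul_meas_ge_le_lintegral hZm θ (μ := ν)).trans hZi
    have h2 : (T : ℝ≥0∞) * (Fintype.card A * 272) = θ * δ := by
      rw [hθ, hk, mul_assoc, ENNReal.div_mul_cancel hδ hδ', mul_assoc]
    rw [h2] at h1
    exact (ENNReal.mul_le_mul_iff_right hθ0 hθt).1 h1
  -- The failure event need not be measurable; it is contained in a superlevel set of the measurable
  -- `Z`.
  refine (measure_mono fun o ho => ?_).trans hmarkov
  by_contra hlt
  simp only [Set.mem_ofPred_eq, not_le] at hlt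
  refine ho ?_
  set ε := R.epsApprox model o
  set b := ENNReal.ofReal B * (maxCard F T ^ (1 / 2 : ℝ) / (N : ℝ≥0∞) ^ (1 / 2 : ℝ)) with hb
  have hb2 : maxCard F T * ENNReal.ofReal (B ^ 2 / N) = b ^ 2 := by
    rw [hb, mul_pow, ENNReal.div_eq_inv_mul, mul_pow, ← ENNReal.inv_pow, rpow_half_sq,
      rpow_half_sq, div_eq_mul_inv, ENNReal.ofReal_mul (by positivity),
      ENNReal.ofReal_inv_of_pos hNR,
      ENNReal.ofReal_natCast, ENNReal.ofReal_pow hB0.le]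
    ring
  by_cases hD : ε ^ 2 + b ^ 2 = ∞
  · have h1 : ε + b = ∞ := by
      rw [ENNReal.add_eq_top] at hD ⊢
      simpa using hD
    rw [h1, ENNReal.mul_top, ENNReal.mul_top, ENNReal.mul_top]
    · exact le_top
    · simp [hT.ne']
    · simp
    · rw [Ne, ENNReal.rpow_eq_zero_iff]
      have h3 := (ENNReal.div_pos (by norm_num : (272 : ℝ≥0∞) ≠ 0) hδ').ne'
      norm_num
      exact hδ'
  have h1 := hZ o (by rw [hb2]; exact hD)
  rw [hb2, ← Finset.sum_product'] at h1
  rw [← Finset.sum_product']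
  set s := Finset.range T ×ˢ (Finset.univ : Finset A) with hs
  have hcs : (s.card : ℝ≥0∞) = k := by simp [hs, hk]
  -- Cauchy-Schwarz over the `T * |A|` pairs of iteration and action.
  have h2 : (∑ x ∈ s, R.regError x.1 x.2 o) ^ 2 ≤ k * ∑ x ∈ s, R.regError x.1 x.2 o ^ 2 := by
    have h3 := ENNReal.rpow_sum_le_const_mul_sum_rpow s (fun x => R.regError x.1 x.2 o)
      (p := 2) (by norm_num)
    rw [hcs] at h3
    norm_num at h3
    exact h3
  have h4 : (∑ x ∈ s, R.regError x.1 x.2 o) ^ 2 ≤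
      (k * ((272 / δ) ^ (1 / 2 : ℝ) * (ε + b))) ^ 2 := by
    calc _ ≤ k * ∑ x ∈ s, R.regError x.1 x.2 o ^ 2 := h2
      _ ≤ k * (θ * (ε + b) ^ 2) := by
          gcongr
          refine h1.trans ?_
          gcongr
          rw [add_sq]
          have : ε ^ 2 + b ^ 2 ≤ ε ^ 2 + 2 * ε * b + b ^ 2 := by gcongr; exact le_self_add
          exact this
      _ = _ := by
          rw [mul_pow k, mul_pow _ (ε + b), rpow_half_sq, hθ]
          ring
  have h5 := (ENNReal.pow_le_pow_left_iff two_ne_zero).1 h4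
  rw [hk, mul_assoc] at h5
  exact h5

end RunRegression

/-! ### Deterministic suboptimality bound -/

section Suboptimality

variable {S A : Type*} [MeasurableSpace S] [Fintype A] [MeasurableSpace A]
  [MeasurableSingletonClass A] {M : MDP S A} {W : MirrorMap A} {C : Set (Transition S A)}
  {η : ℝ} {T N : ℕ} {F : ℕ → A → Set (S → ℝ)} {Ω : Type*} [mΩ : MeasurableSpace Ω]
  {ν : Measure Ω}

/-- Pessimism and the performance difference lemma. -/
lemma Run.value_sub_outputValue_le (R : Run M W C η T N F ν) (hT : 0 < T) {Pstar : Transition S A}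
    (hP : Pstar ∈ C) (π : Policy S A) (o : Ω) :
    value M Pstar π - R.outputValue Pstar o ≤ (T : ℝ)⁻¹ * (1 - M.γ)⁻¹ *
      (M.γ * ∑ t ∈ Finset.range T, ∫ x, (∫ s, Vfun M (R.model t o) (R.policy t o) s ∂(Pstar.1 x) -
          ∫ s, Vfun M (R.model t o) (R.policy t o) s ∂((R.model t o).1 x)) ∂(occupancy M Pstar π) +
        ∫ s, ∑ t ∈ Finset.range T, ∑ a, (π.prob s a - (R.policy t o).prob s a) *
          Qfun M (R.model t o) (R.policy t o) s a ∂(stateOccupancy M Pstar π)) := by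
  have hTR : (0 : ℝ) < T := by exact_mod_cast hT
  have h1 : value M Pstar π - R.outputValue Pstar o =
      (T : ℝ)⁻¹ * ∑ t ∈ Finset.range T, (value M Pstar π - value M Pstar (R.policy t o)) := by
    rw [Finset.sum_sub_distrib, Run.outputValue, Finset.sum_const, Finset.card_range, nsmul_eq_mul,
      mul_sub, inv_mul_cancel_left₀ hTR.ne']
  have hint (t : ℕ) : Integrable (fun s => ∑ a, (π.prob s a - (R.policy t o).prob s a) *
      Qfun M (R.model t o) (R.policy t o) s a) (stateOccupancy M Pstar π) := by
    refine integrable_finsetSum _ fun a _ => integrable_of_bounded _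
      (((π.measurable_prob a).sub ((R.policy t o).measurable_prob a)).mul
        (measurable_Qfun_left M _ _ a)) (C := (1 - M.γ)⁻¹) fun s => ?_
    rw [abs_mul]
    exact (mul_le_of_le_one_left (abs_nonneg _) (abs_sub_le_one_of_mem_stdSimplex
      (π.mem_simplex s) ((R.policy t o).mem_simplex s) a)).trans (abs_Qfun_le M _ _ s a)
  rw [h1, integral_finsetSum _ fun t _ => hint t, mul_assoc, Finset.mul_sum _ _ M.γ,
    ← Finset.sum_add_distrib, Finset.mul_sum _ _ (1 - M.γ)⁻¹]
  refine mul_le_mul_of_nonneg_left (Finset.sum_le_sum fun t ht => ?_) (by positivity)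
  have ht := Finset.mem_range.1 ht
  rw [← value_sub_value M Pstar π (R.model t o) (R.policy t o)]
  -- Pessimism: `Pstar` competes in the minimization, so the value under `P_t` is at most the value
  -- under `Pstar`.
  exact sub_le_sub_left (R.oracle_min t ht o Pstar hP) _

/-- The integrated mirror ascent regret of a run. -/
lemma Run.ofReal_regret_le (R : Run M W C η T N F ν) (hη : 0 < η) {c D : ℝ}
    (hc : ∀ x : A → ℝ, ∑ a, |x a| ≤ c * W.nrm x)
    (hD : ∀ p ∈ stdSimplex ℝ A, W.bregman p (fun _ => (Fintype.card A : ℝ)⁻¹) ≤ D)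
    (hF : ∀ t < T, ∀ a, ∀ f ∈ F t a, Measurable f) (P : Transition S A) (π : Policy S A)
    (hκ : densitySup (stateOccupancy M P π) M.μ₀ < ∞) (o : Ω) :
    ENNReal.ofReal (∫ s, ∑ t ∈ Finset.range T, ∑ a, (π.prob s a - (R.policy t o).prob s a) *
        Qfun M (R.model t o) (R.policy t o) s a ∂(stateOccupancy M P π)) ≤
      ENNReal.ofReal (1 / η * D + T * (η * (c * (1 - M.γ)⁻¹) ^ 2 / 2)) +
      (densitySup (stateOccupancy M P π) M.μ₀ * ENNReal.ofReal (1 - M.γ)⁻¹) ^ (1 / 2 : ℝ) *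
        ∑ t ∈ Finset.range T, ∑ a, R.regError t a o := by
  have h0 := M.one_sub_pos
  set d := stateOccupancy M P π
  have hint : Integrable (fun s => ∑ t ∈ Finset.range T, ∑ a,
      (π.prob s a - (R.policy t o).prob s a) * Qfun M (R.model t o) (R.policy t o) s a) d := by
    refine integrable_finsetSum _ fun t _ => integrable_finsetSum _ fun a _ =>
      integrable_of_bounded _ (((π.measurable_prob a).sub ((R.policy t o).measurable_prob a)).mul
        (measurable_Qfun_left M _ _ a)) (C := (1 - M.γ)⁻¹) fun s => ?_
    rw [abs_mul]
    exact (mul_le_of_le_one_left (abs_nonneg _) (abs_sub_le_one_of_mem_stdSimplex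
      (π.mem_simplex s) ((R.policy t o).mem_simplex s) a)).trans (abs_Qfun_le M _ _ s a)
  set e : ℕ → A → S → ℝ := fun t a s =>
    augQ M W η (R.model t o) (R.policy t o) a s - R.fhat t a o s with he
  have hem (t : ℕ) (ht : t < T) (a : A) : Measurable (e t a) :=
    (measurable_augQ M W η _ _ a).sub (hF t ht a _ (R.fhat_mem t ht a o))
  -- At each state the iterates perform mirror ascent against the fixed comparator vector `π.prob
  -- s`.
  have hpt (s : S) : ∑ t ∈ Finset.range T, ∑ a,
      (π.prob s a - (R.policy t o).prob s a) * Qfun M (R.model t o) (R.policy t o) s a ≤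
      (1 / η * D + T * (η * (c * (1 - M.γ)⁻¹) ^ 2 / 2)) +
        ∑ t ∈ Finset.range T, ∑ a, |e t a s| := by
    have h1 := MirrorMap.mirror_regret (W := W) hη hc (T := T) (p := π.prob s)
      (x := fun t => (R.policy t o).prob s)
      (Q := fun t a => Qfun M (R.model t o) (R.policy t o) s a)
      (f := fun t a => R.fhat t a o s) (fun t a => abs_Qfun_le M _ _ s a) (by positivity)
      (π.mem_simplex s) (fun t => (R.policy t o).mem_simplex s)
      (funext fun a => R.policy_zero o s a) (fun t ht => R.policy_succ t ht o s)
    refine h1.trans ?_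
    have h2 : 1 / η * W.bregman (π.prob s) (fun _ => (Fintype.card A : ℝ)⁻¹) ≤ 1 / η * D :=
      mul_le_mul_of_nonneg_left (hD _ (π.mem_simplex s)) (by positivity)
    simp only [he, augQ]
    linarith
  refine (ofReal_integral_le_lintegral hint).trans ?_
  have hsplit (s : S) : ENNReal.ofReal (∑ t ∈ Finset.range T, ∑ a,
      (π.prob s a - (R.policy t o).prob s a) * Qfun M (R.model t o) (R.policy t o) s a) ≤
      ENNReal.ofReal (1 / η * D + T * (η * (c * (1 - M.γ)⁻¹) ^ 2 / 2)) +
        ∑ t ∈ Finset.range T, ∑ a, ‖e t a s‖ₑ := by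
    refine (ENNReal.ofReal_le_ofReal (hpt s)).trans (ENNReal.ofReal_add_le.trans ?_)
    gcongr
    rw [ENNReal.ofReal_sum_of_nonneg fun t _ => Finset.sum_nonneg fun a _ => abs_nonneg _]
    refine Finset.sum_le_sum fun t _ => ?_
    rw [ENNReal.ofReal_sum_of_nonneg fun a _ => abs_nonneg _]
    exact Finset.sum_le_sum fun a _ => by rw [← Real.norm_eq_abs, ofReal_norm]
  refine (lintegral_mono hsplit).trans ?_
  rw [lintegral_add_left measurable_const, lintegral_const, measure_univ, mul_one,
    lintegral_finsetSum _ fun t ht => Finset.measurable_fun_sum _ fun a _ =>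
      (hem t (Finset.mem_range.1 ht) a).enorm, Finset.mul_sum]
  gcongr with t ht
  have ht := Finset.mem_range.1 ht
  rw [lintegral_finsetSum _ fun a _ => (hem t ht a).enorm, Finset.mul_sum]
  exact Finset.sum_le_sum fun a _ =>
    lintegral_enorm_le_eLpNorm M P (R.model t o) π (R.policy t o) hκ (hem t ht a)

/-- With `x = 1 - γ`, the full power comes from the performance difference and the half power from
the change of measure. -/
lemma rpow_three_halves {x : ℝ} (hx : 0 < x) :
    ENNReal.ofReal (1 / x ^ (3 / 2 : ℝ)) =
      ENNReal.ofReal x⁻¹ * ENNReal.ofReal x⁻¹ ^ (1 / 2 : ℝ) := by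
  rw [ENNReal.ofReal_rpow_of_nonneg (by positivity) (by norm_num),
    ← ENNReal.ofReal_mul (by positivity)]
  congr 1
  rw [Real.inv_rpow hx.le, ← mul_inv, one_div, show (3 / 2 : ℝ) = 1 + 1 / 2 by norm_num,
    Real.rpow_add hx, Real.rpow_one]

/-- The suboptimality of the output in terms of the model error and the regression errors. -/
lemma Run.ofReal_suboptimality_le (R : Run M W C η T N F ν) (hη : 0 < η) (hT : 0 < T) {c D : ℝ}
    (hc : ∀ x : A → ℝ, ∑ a, |x a| ≤ c * W.nrm x)
    (hD : ∀ p ∈ stdSimplex ℝ A, W.bregman p (fun _ => (Fintype.card A : ℝ)⁻¹) ≤ D)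
    (hF : ∀ t < T, ∀ a, ∀ f ∈ F t a, Measurable f) {Pstar : Transition S A} (hP : Pstar ∈ C)
    (π : Policy S A) (ρ : Measure (S × A)) [IsFiniteMeasure ρ]
    (hρ : densitySup (occupancy M Pstar π) ρ < ∞)
    (hκ : densitySup (stateOccupancy M Pstar π) M.μ₀ < ∞) (o : Ω) :
    ENNReal.ofReal (value M Pstar π - R.outputValue Pstar o) ≤
      ENNReal.ofReal (M.γ / (1 - M.γ) ^ 2) *
        (densitySup (occupancy M Pstar π) ρ * epsEst ρ Pstar C) +
      ENNReal.ofReal ((T : ℝ)⁻¹ * (1 - M.γ)⁻¹ *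
        (1 / η * D + T * (η * (c * (1 - M.γ)⁻¹) ^ 2 / 2))) +
      ENNReal.ofReal (1 / (1 - M.γ) ^ (3 / 2 : ℝ)) *
        densitySup (stateOccupancy M Pstar π) M.μ₀ ^ (1 / 2 : ℝ) *
        ((T : ℝ≥0∞)⁻¹ * ∑ t ∈ Finset.range T, ∑ a, R.regError t a o) := by
  have h0 := M.one_sub_pos
  have hγ := M.γ_mem.1
  have hTR : (0 : ℝ) < T := by exact_mod_cast hT
  have hT0 : (T : ℝ≥0∞) ≠ 0 := by exact_mod_cast hT.ne'
  set κ := densitySup (stateOccupancy M Pstar π) M.μ₀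
  set K := (1 - M.γ)⁻¹ with hK
  have hK0 : 0 < K := by positivity
  set x := densitySup (occupancy M Pstar π) ρ * epsEst ρ Pstar C
  set X : ℕ → ℝ := fun t => ∫ x, (∫ s, Vfun M (R.model t o) (R.policy t o) s ∂(Pstar.1 x) -
      ∫ s, Vfun M (R.model t o) (R.policy t o) s ∂((R.model t o).1 x)) ∂(occupancy M Pstar π)
  set G := ∑ t ∈ Finset.range T, ∑ a, R.regError t a o
  have hX : ENNReal.ofReal (∑ t ∈ Finset.range T, X t) ≤ T * (ENNReal.ofReal K * x) := by
    have h1 : ∀ s : Finset ℕ, ENNReal.ofReal (∑ t ∈ s, X t) ≤ ∑ t ∈ s, ENNReal.ofReal (X t) := by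
      intro s
      classical
      induction s using Finset.induction_on with
      | empty => simp
      | insert t s ht ih =>
        rw [Finset.sum_insert ht, Finset.sum_insert ht]
        exact ENNReal.ofReal_add_le.trans (by gcongr)
    refine (h1 _).trans ?_
    refine (Finset.sum_le_card_nsmul (Finset.range T) _ (ENNReal.ofReal K * x)
      fun t ht => ?_).trans_eq (by rw [Finset.card_range, nsmul_eq_mul])
    exact ofReal_modelError_le M Pstar (R.model t o) π (R.policy t o) ρ hρ C
      (R.oracle_mem t (Finset.mem_range.1 ht) o)
  have hY := R.ofReal_regret_le hη hc hD hF Pstar π hκ o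
  refine (ENNReal.ofReal_le_ofReal (R.value_sub_outputValue_le hT hP π o)).trans ?_
  rw [ENNReal.ofReal_mul (by positivity)]
  refine (mul_le_mul_right (ENNReal.ofReal_add_le.trans (add_le_add
    ((ENNReal.ofReal_mul hγ).trans_le (mul_le_mul_right hX _)) hY)) _).trans_eq ?_
  have hTi : ENNReal.ofReal ((T : ℝ)⁻¹ * K) = (T : ℝ≥0∞)⁻¹ * ENNReal.ofReal K := by
    rw [ENNReal.ofReal_mul (by positivity), ENNReal.ofReal_inv_of_pos hTR, ENNReal.ofReal_natCast]
  rw [mul_add, mul_add, ← ENNReal.ofReal_mul (by positivity), ← add_assoc, hTi,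
    rpow_three_halves h0, ENNReal.mul_rpow_of_nonneg _ _ (by norm_num)]
  congr 1
  · congr 1
    -- One factor `K` is the prefactor of the performance difference, the other the bound on the
    -- value function.
    have h1 : ENNReal.ofReal (M.γ / (1 - M.γ) ^ 2) =
        ENNReal.ofReal K * ENNReal.ofReal M.γ * ENNReal.ofReal K := by
      rw [← ENNReal.ofReal_mul (by positivity), ← ENNReal.ofReal_mul (by positivity)]
      congr 1
      rw [hK]
      field_simp
    rw [h1]
    calc _ = (T : ℝ≥0∞)⁻¹ * T *
          (ENNReal.ofReal K * ENNReal.ofReal M.γ * ENNReal.ofReal K * x) := by ring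
      _ = _ := by rw [ENNReal.inv_mul_cancel hT0 (by simp), one_mul]
  · ring

/-- The optimization error for the step size of the algorithm. -/
lemma stepSize_error {L g c D : ℝ} (hL : 0 < L) (hg : 0 < g) (hT : 0 < T)
    {η : ℝ} (hη : η = g * (L / √T)) :
    (T : ℝ)⁻¹ * g⁻¹ * (1 / η * D + T * (η * (c * g⁻¹) ^ 2 / 2)) =
      (D / L + L * c ^ 2 / 2) * (1 / g ^ 2 * (1 / √T)) := by
  have hTR : (0 : ℝ) < T := by exact_mod_cast hT
  have hs : 0 < √(T : ℝ) := Real.sqrt_pos.2 hTR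
  have hsq : (T : ℝ) = √(T : ℝ) ^ 2 := (Real.sq_sqrt hTR.le).symm
  rw [hη]
  set r := √(T : ℝ)
  rw [hsq]
  field_simp

end Suboptimality

/-! ### High-probability bound and degenerate cases -/

section HighProbability

variable {S A : Type*} [MeasurableSpace S] [Fintype A] [MeasurableSpace A]
  [MeasurableSingletonClass A] {M : MDP S A} {W : MirrorMap A} {C : Set (Transition S A)}
  {η : ℝ} {T N : ℕ} {F : ℕ → A → Set (S → ℝ)} {Ω : Type*} [mΩ : MeasurableSpace Ω]
  {ν : Measure Ω}

/-- Total mass one excludes the constant `0`. Nonvanishing matters because `0 * ∞ = 0` would spoil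
the cases of an infinite bound. -/
lemma densitySup_ne_zero {X : Type*} [MeasurableSpace X] (ν μ : Measure X)
    [IsProbabilityMeasure ν] [IsFiniteMeasure μ] : densitySup ν μ ≠ 0 := by
  intro h
  have h1 := le_densitySup_smul (ν := ν) (μ := μ) (by simp [h]) Set.univ
  simp [h] at h1

/-- With a single action there is only one policy. -/
lemma Run.value_sub_outputValue_eq_zero [Subsingleton A] (R : Run M W C η T N F ν) (hT : 0 < T)
    (P : Transition S A) (π : Policy S A) (o : Ω) : value M P π - R.outputValue P o = 0 := by
  have hπ (t : ℕ) : R.policy t o = π := Policy.ext_prob fun s => funext fun a => by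
    have h1 := ((R.policy t o).mem_simplex s).2
    have h2 := (π.mem_simplex s).2
    rw [Fintype.sum_subsingleton _ a] at h1 h2
    rw [h1, h2]
  have hTR : (T : ℝ) ≠ 0 := by exact_mod_cast hT.ne'
  simp [Run.outputValue, hπ, hTR]

lemma one_le_maxCard [Nonempty A] (hT : 0 < T) (hF : ∀ t < T, ∀ a, (F t a).Nonempty) :
    1 ≤ maxCard F T := by
  obtain ⟨a⟩ := ‹Nonempty A›
  refine le_trans ?_ (encard_le_maxCard (F := F) hT a)
  exact_mod_cast Set.one_le_encard_iff_nonempty.2 (hF 0 hT a)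

/-- The suboptimality bound of a run whose confidence set contains the true model. -/
lemma Run.measure_suboptimality_le [Nonempty A] [IsProbabilityMeasure ν]
    (R : Run M W C (stepSize M T) T N F ν) {model : Set (Transition S A)} (hC : C ⊆ model)
    {Pstar : Transition S A} (hP : Pstar ∈ C) (π : Policy S A) (ρ : Measure (S × A))
    [IsFiniteMeasure ρ] (hρ : densitySup (occupancy M Pstar π) ρ < ∞) (hT : 0 < T) (hN : 0 < N)
    {B : ℝ} (hB : 1 / (1 - M.γ) ≤ B)
    (hF : ∀ t < T, ∀ a, ∀ f ∈ F t a, Measurable f ∧ ∀ s, |f s| ≤ B) {c D : ℝ}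
    (hc : ∀ x : A → ℝ, ∑ a, |x a| ≤ c * W.nrm x) (hD0 : 0 ≤ D)
    (hD : ∀ p ∈ stdSimplex ℝ A, W.bregman p (fun _ => (Fintype.card A : ℝ)⁻¹) ≤ D)
    {δ : ℝ≥0∞} (hδ : δ ≠ 0) (hδ' : δ ≠ ∞) {c₁ c₂ : ℝ≥0} (hc₁ : 1 ≤ c₁)
    (hc₁' : (272 / δ) ^ (1 / 2 : ℝ) ≤ c₁)
    (hc₂ : ENNReal.ofReal (D / √(2 * Real.log (Fintype.card A)) +
      √(2 * Real.log (Fintype.card A)) * c ^ 2 / 2) ≤ c₂) :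
    ν {o | ¬ ENNReal.ofReal (value M Pstar π - R.outputValue Pstar o) ≤
      c₁ * (ENNReal.ofReal (M.γ / (1 - M.γ) ^ 2 + M.γ / (1 - M.γ) ^ 3) *
          densitySup (occupancy M Pstar π) ρ * epsEst ρ Pstar C) +
      c₂ * ENNReal.ofReal (1 / (1 - M.γ) ^ 2 * (1 / √T)) +
      c₁ * (ENNReal.ofReal (1 / (1 - M.γ) ^ (3 / 2 : ℝ)) * (Fintype.card A : ℝ≥0∞) *
          densitySup (stateOccupancy M Pstar π) M.μ₀ ^ (1 / 2 : ℝ) *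
          (R.epsApprox model o +
            ENNReal.ofReal B * (maxCard F T ^ (1 / 2 : ℝ) / (N : ℝ≥0∞) ^ (1 / 2 : ℝ))))} ≤ δ := by
  have h0 := M.one_sub_pos
  have hγ := M.γ_mem.1
  have hTR : (0 : ℝ) < T := by exact_mod_cast hT
  have hB0 : 0 < B := lt_of_lt_of_le (one_div_pos.2 h0) hB
  have hempty {p : Ω → Prop} (h : ∀ o, p o) : ν {o | ¬ p o} ≤ δ := by simp [h]
  -- For a single action `log |A| = 0`, so the step size vanishes and the mirror analysis is void.
  rcases subsingleton_or_nontrivial A with hA | hA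
  · refine hempty fun o => ?_
    rw [R.value_sub_outputValue_eq_zero hT, ENNReal.ofReal_zero]
    exact zero_le
  set L := √(2 * Real.log (Fintype.card A)) with hLdef
  have hL : 0 < L := Real.sqrt_pos.2 (mul_pos two_pos
    (Real.log_pos (by exact_mod_cast Fintype.one_lt_card)))
  have hη : stepSize M T = (1 - M.γ) * (L / √T) := by
    rw [stepSize, Real.sqrt_div' _ hTR.le]
  have hη0 : 0 < stepSize M T := by rw [hη]; positivity
  set κ := densitySup (stateOccupancy M Pstar π) M.μ₀ with hκdef
  have hκ0 : κ ≠ 0 := densitySup_ne_zero _ _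
  have hm0 : maxCard F T ≠ 0 := by
    obtain ⟨o⟩ : Nonempty Ω := nonempty_of_isProbabilityMeasure ν
    exact (zero_lt_one.trans_le
      (one_le_maxCard hT fun t ht a => ⟨_, R.fhat_mem t ht a o⟩)).ne'
  set E : ℝ≥0∞ := ENNReal.ofReal B * (maxCard F T ^ (1 / 2 : ℝ) / (N : ℝ≥0∞) ^ (1 / 2 : ℝ))
    with hE
  have hB' : ENNReal.ofReal B ≠ 0 := (ENNReal.ofReal_pos.2 hB0).ne'
  have hE0 : E ≠ 0 := by
    refine mul_ne_zero hB' (ENNReal.div_ne_zero.2 ⟨?_, by finiteness⟩)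
    simp [ENNReal.rpow_eq_zero_iff, hm0]
  have hc0 : (c₁ : ℝ≥0∞) ≠ 0 := by exact_mod_cast (zero_lt_one.trans_le hc₁).ne'
  have hq0 : ENNReal.ofReal (1 / (1 - M.γ) ^ (3 / 2 : ℝ)) ≠ 0 :=
    (ENNReal.ofReal_pos.2 (by positivity)).ne'
  have hcard : (Fintype.card A : ℝ≥0∞) ≠ 0 := by simp
  -- An infinite density ratio, and below an infinite class, makes the right-hand side infinite
  -- since all other factors are nonzero.
  by_cases hκt : κ = ∞
  · refine hempty fun o => ?_
    rw [hκt, ENNReal.top_rpow_of_pos (by norm_num), ENNReal.mul_top (mul_ne_zero hq0 hcard),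
      ENNReal.top_mul (by simp [hE0]), ENNReal.mul_top hc0, add_top]
    exact le_top
  by_cases hmt : maxCard F T = ∞
  · refine hempty fun o => ?_
    have hEt : E = ∞ := by
      rw [hE, hmt, ENNReal.top_rpow_of_pos (by norm_num), ENNReal.top_div_of_ne_top (by finiteness),
        ENNReal.mul_top hB']
    have hκr : κ ^ (1 / 2 : ℝ) ≠ 0 := by simp [ENNReal.rpow_eq_zero_iff, hκ0]
    rw [hEt, add_top, ENNReal.mul_top (mul_ne_zero (mul_ne_zero hq0 hcard) hκr),
      ENNReal.mul_top hc0, add_top]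
    exact le_top
  have hfin (t : ℕ) (ht : t < T) (a : A) : (F t a).Finite := by
    by_contra h
    have h1 := encard_le_maxCard (F := F) ht a
    rw [Set.encard_eq_top_iff.2 h] at h1
    exact hmt (by simpa using h1)
  refine (measure_mono fun o => mt fun ho => ?_).trans
    (R.measure_sum_regError_le hη0 hfin hC hN hB hF hδ hδ' hT)
  refine (R.ofReal_suboptimality_le hη0 hT hc hD (fun t ht a f hf => (hF t ht a f hf).1) hP π ρ hρ
    (lt_top_iff_ne_top.2 hκt) o).trans ?_
  have hT0 : (T : ℝ≥0∞) ≠ 0 := by exact_mod_cast hT.ne'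
  refine add_le_add (add_le_add ?_ ?_) ?_
  · rw [← mul_assoc]
    refine le_trans ?_ (le_mul_of_one_le_left zero_le (by exact_mod_cast hc₁))
    gcongr
    -- The term `γ / (1 - γ) ^ 2` alone suffices; the cubic one is slack.
    exact le_add_of_nonneg_right (by positivity)
  · rw [stepSize_error hL h0 hT hη, ENNReal.ofReal_mul (by positivity)]
    gcongr
  · calc _ ≤ ENNReal.ofReal (1 / (1 - M.γ) ^ (3 / 2 : ℝ)) * κ ^ (1 / 2 : ℝ) *
          ((T : ℝ≥0∞)⁻¹ * (T * (Fintype.card A * (c₁ * (R.epsApprox model o + E))))) := by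
          gcongr
          exact ho.trans (by gcongr)
      _ = (T : ℝ≥0∞)⁻¹ * T * (c₁ * (ENNReal.ofReal (1 / (1 - M.γ) ^ (3 / 2 : ℝ)) *
          Fintype.card A * κ ^ (1 / 2 : ℝ) * (R.epsApprox model o + E))) := by ring
      _ = _ := by rw [ENNReal.inv_mul_cancel hT0 (by simp), one_mul]

end HighProbability

end MoMA

end

/-! ### Choice of constants and the main theorem -/

theorem mainTheorem1 (δ : ℝ≥0∞) (hδ : 0 < δ) :
    ∃ c₁ : ℝ≥0, ∀ (A : Type*) [Fintype A] [Nonempty A] [MeasurableSpace A]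
      [MeasurableSingletonClass A] (W : MoMA.MirrorMap A),
    ∃ c₂ : ℝ≥0, ∀ (S : Type*) [MeasurableSpace S] (M : MoMA.MDP S A)
      (model : Set (MoMA.Transition S A)) (Pstar : MoMA.Transition S A) (_ : Pstar ∈ model)
      (ρ : Measure (S × A)) [IsProbabilityMeasure ρ] (πdag : MoMA.Policy S A)
      (_ : MoMA.densitySup (MoMA.occupancy M Pstar πdag) ρ < ∞)
      (n : ℕ) (loss : MoMA.Dataset S A n → MoMA.Transition S A → ℝ)
      (Phat : MoMA.Dataset S A n → MoMA.Transition S A)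
      (_ : ∀ᵐ D ∂(MoMA.dataLaw M ρ Pstar n),
        Phat D ∈ model ∧ ∀ P ∈ model, loss D (Phat D) ≤ loss D P)
      (α : ℝ) (p : ℝ≥0∞)
      (_ : MoMA.dataLaw M ρ Pstar n
        {D | Pstar ∉ MoMA.confSet model (loss D) (Phat D) α} ≤ p)
      (T N : ℕ) (_ : 0 < T) (_ : 0 < N) (B : ℝ) (_ : 1 / (1 - M.γ) ≤ B)
      (F : ℕ → A → Set (S → ℝ))
      (_ : ∀ t < T, ∀ a, ∀ f ∈ F t a, Measurable f ∧ ∀ s, |f s| ≤ B),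
    MoMA.dataLaw M ρ Pstar n
      {D | ¬ ∀ (Ω : Type*) [MeasurableSpace Ω] (ν : Measure Ω) [IsProbabilityMeasure ν]
        (R : MoMA.Run M W (MoMA.confSet model (loss D) (Phat D) α) (MoMA.stepSize M T) T N F ν),
        ν {o | ¬ ENNReal.ofReal (MoMA.value M Pstar πdag - R.outputValue Pstar o) ≤
          c₁ * (ENNReal.ofReal (M.γ / (1 - M.γ) ^ 2 + M.γ / (1 - M.γ) ^ 3) *
              MoMA.densitySup (MoMA.occupancy M Pstar πdag) ρ *
              MoMA.epsEst ρ Pstar (MoMA.confSet model (loss D) (Phat D) α)) +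
          c₂ * ENNReal.ofReal (1 / (1 - M.γ) ^ 2 * (1 / √T)) +
          c₁ * (ENNReal.ofReal (1 / (1 - M.γ) ^ (3 / 2 : ℝ)) * (Fintype.card A : ℝ≥0∞) *
              MoMA.densitySup (MoMA.stateOccupancy M Pstar πdag) M.μ₀ ^ (1 / 2 : ℝ) *
              (R.epsApprox model o +
                ENNReal.ofReal B * (MoMA.maxCard F T ^ (1 / 2 : ℝ) / (N : ℝ≥0∞) ^ (1 / 2 : ℝ))))}
          ≤ δ} ≤ p := by
  -- Truncation at `1` covers `δ = ∞`; the smaller level gives the stronger conclusion.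
  set δ' : ℝ≥0∞ := min δ 1 with hδ'
  have hδ0 : δ' ≠ 0 := (lt_min hδ one_pos).ne'
  have hδt : δ' ≠ ∞ := (min_le_right _ _).trans_lt ENNReal.one_lt_top |>.ne
  set r : ℝ≥0∞ := (272 / δ') ^ (1 / 2 : ℝ)
  have hr : r ≠ ∞ :=
    ENNReal.rpow_ne_top_of_nonneg (by norm_num) (ENNReal.div_ne_top (by norm_num) hδ0)
  -- The summand `1` serves the model error, `r = √(272 / δ')` the regression error.
  refine ⟨1 + r.toNNReal, fun A _ _ _ _ W => ?_⟩
  obtain ⟨c, hc⟩ := W.exists_sum_abs_le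
  obtain ⟨D, hD0, hD⟩ := W.exists_bregman_unif_le
  refine ⟨(D / √(2 * Real.log (Fintype.card A)) +
    √(2 * Real.log (Fintype.card A)) * c ^ 2 / 2).toNNReal, ?_⟩
  intro S _ M model Pstar hmodel ρ _ π hρ n loss Phat _ α p hp T N hT hN B hB F hF
  -- The only exceptional data sets are those whose confidence set misses `Pstar`.
  refine (measure_mono fun data => mt fun hdata => ?_).trans hp
  intro Ω _ ν _ R
  refine (R.measure_suboptimality_le (fun P hP => hP.1) hdata π ρ hρ hT hN hB hF hc hD0 hD hδ0 hδt
    (le_add_of_nonneg_right zero_le) ?_ le_rfl).trans (min_le_left _ _)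
  rw [ENNReal.coe_add, ENNReal.coe_toNNReal hr]
  exact le_add_of_nonneg_left zero_le
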